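/- **Setting.** Let $\nu\in\{2,3\}$. Let $\Omega_1,\Omega_2\subset\mathbb R^\nu$ be disjoint open sets and let $\gamma\subset\partial\Omega_1\cap\partial\Omega_2$. For $i=1,2$ let $\Omega_i^h$ be a finite geometrically conforming partition of $\overline{\Omega_i}$ into simplices and/or parallelotopes (affine images of the unit simplex and the unit cube; two elements meet in a common, possibly empty, face) such that $\gamma$ is a union of facets of $\Omega_i^h$. The two meshes are independent and need not match on $\gamma$. The meshes are quasi-uniform with constants $\sigma,\tau$: every element $K$ of $\Omega^h_i$ contains a ball of radius $r_K>0$ with $\operatorname{diam}K\le\sigma r_K$, and $\max_{K'}\operatorname{diam}K'\le\tau\operatorname{diam}K$, the maximum being over the elements of $\Omega_i^h$. Let $h_{i,\gamma}$ be the largest diameter of a facet of $\Omega_i^h$ on $\gamma$. Let $N_{i,r}$ be the nodal basis functions of the lowest-order ($P_1$ on simplices, $Q_1$ on parallelotopes) continuous finite element space on $\Omega_i^h$. With $\Gamma_i=\partial\Omega_i\setminus\gamma$, the interface nodes are the mesh nodes on $\gamma\setminus\overline{\Gamma_i}$ and the interior nodes are the mesh nodes in $\Omega_i$. Let $S^h_{i,\gamma}$,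 $S^h_{i,0}$ be the spans of the basis functions of the interface and of the interior nodes, $S^h_{i,D}=S^h_{i,\gamma}\oplus S^h_{i,0}$, and $G^h_i=S^h_{i,\gamma}|_\gamma$. Put $$b(v_1,v_2;\mu)=(v_1-v_2,\mu)_{0,\gamma},\qquad \|\{v_1,v_2\}\|_V^2=\|v_1\|_{0,\Omega_1}^2+\|v_2\|_{0,\Omega_2}^2,\qquad \|\mu\|_W=\|\mu\|_{0,\gamma}.$$ Let $M_{i,D}=\begin{pmatrix}M_{i,\gamma\gamma}&M_{i,\gamma0}\\M_{i,0\gamma}&M_{i,00}\end{pmatrix}$ be the mass matrix of $S^h_{i,D}$. When the multiplier space is built on $G^h_k$, let $G_{i,\gamma}$ be the matrix with entries $(N_{k,r},N_{i,s})_{0,\gamma}$, with $r$, $s$ running over the interface nodes of sides $k$ and $i$. Let $\Phi_{i,\gamma}$, $\Phi_{i,0}$ be reduced basis matrices with linearly independent columns (for instance POD bases), whose rows are indexed by the interface and by the interior nodes of $\Omega^h_i$. Let $\widetilde S^h_{i,\gamma}$, $\widetilde S^h_{i,0}$ be the spans of the finite element functions whose coefficient vectors are their columns, $\widetilde S^h_{i,C}=\widetilde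 S^h_{i,\gamma}\oplus\widetilde S^h_{i,0}$, and $\widetilde G^h_{i,\gamma}=\widetilde S^h_{i,\gamma}|_\gamma$. Let $\widetilde M_1$ be the projected mass matrix with blocks $\Phi_{1,p}^TM_{1,pq}\Phi_{1,q}$, $p,q\in\{\gamma,0\}$. **Composite basis ROM on $\Omega_1$, finite element FOM on $\Omega_2$.** The state space is $\widetilde V_H^h=\widetilde S^h_{1,C}\times S^h_{2,D}$. The Lagrange multiplier space $\widehat W^h$, the matrices $\widehat G_i=[\widehat G_{i,\gamma},0]$ and the mesh size $\widehat h_\gamma$ are * option rLM ($k=1$): $\widehat W^h=\widetilde G^h_{1,\gamma}$, $\ \widehat G_{1,\gamma}=\Phi_{1,\gamma}^TG_{1,\gamma}\Phi_{1,\gamma}$, $\ \widehat G_{2,\gamma}=\Phi_{1,\gamma}^TG_{2,\gamma}$, $\ \widehat h_\gamma=h_{1,\gamma}$; * option fLM ($k=2$): $\widehat W^h=G^h_2$, $\ \widehat G_{1,\gamma}=G_{1,\gamma}\Phi_{1,\gamma}$, $\ \widehat G_{2,\gamma}=G_{2,\gamma}$, $\ \widehat h_\gamma=h_{2,\gamma}$.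 **Claim.** There are constants $\beta,C_1,C_2>0$ that depend only on $\nu,\sigma,\tau$ (not on the domains, the meshes, the mesh sizes, the reduced bases or the option) such that in every such setting and for both options: 1. There is a linear operator $\mathcal Q:\widehat W^h\to\widetilde V^h_H$ such that, for all $\mu\in\widehat W^h$, $$\|\mu\|_W^2\le C_1\,b(\mathcal Q\mu;\mu),\qquad \|\mathcal Q\mu\|_V\le C_2\,\widehat h_\gamma^{1/2}\,\|\mu\|_W .$$ It is $\mathcal Q\mu=\{u^\mu_1,0\}$ for rLM and $\mathcal Q\mu=-\{0,u^\mu_2\}$ for fLM, where $u_i^\mu$ is the finite element function that has the coefficients of $\mu$ at the interface nodes of $\Omega^h_i$ and zero coefficients at all other nodes. 2. If $\widehat h_\gamma<1$, then for all $\mu\in\widehat W^h$ $$\sup_{v\in\widetilde V_H^h}\frac{b(v;\mu)}{\|v\|_V}\ \ge\ \beta\,\|\mu\|_W$$ (with the convention that $v=0$ contributes the value $0$). 3. $\widetilde M_1$ and $M_{2,D}$ are symmetric positive definite, and so is the Schur complement $$\widehat S=\widehat G_1\widetilde M_1^{-1}\widehat G_1^T+\widehat G_2M_{2,D}^{-1}\widehat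 G_2^T .$$ The same $\beta$ is also an inf-sup constant for the composite basis ROM-ROM coupling: for $k=1,2$, if $h_{k,\gamma}<1$, then the inequality in item 2 holds with state space $\widetilde S^h_{1,C}\times\widetilde S^h_{2,C}$ and multiplier space $\widetilde G^h_{k,\gamma}$. -/

import Mathlib

open MeasureTheory Set
open scoped MeasureTheory Matrix

noncomputable section

namespace RomFom

/-- Euclidean space `ℝ^ν`. -/
abbrev Pt (ν : ℕ) : Type := EuclideanSpace ℝ (Fin ν)

/-! ### Lowest-order Lagrange elements -/

/-- The two reference elements: the unit simplex and the unit cube of `ℝ^ν`. -/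
inductive ElementShape : Type
  | simplex
  | cube

/-- The reference vertex labelled by `s ⊆ {0, …, ν - 1}`: the point whose `j`-th coordinate
is `1` if `j ∈ s` and `0` otherwise. -/
def refVertex {ν : ℕ} (s : Finset (Fin ν)) : Pt ν :=
  WithLp.toLp 2 (fun j => if j ∈ s then (1 : ℝ) else 0)

/-- Labels of the vertices of the reference element: for the simplex `∅` (the origin) and the
singletons (the unit vectors), for the cube all subsets. -/
def ElementShape.labels (ν : ℕ) : ElementShape → Finset (Finset (Fin ν))
  | simplex => Finset.univ.filter (fun s => s.card ≤ 1)
  | cube => Finset.univ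

/-- Nodal shape function of the vertex labelled by `s`: on the simplex the barycentric (`P₁`)
coordinates, on the cube the multilinear (`Q₁`) functions. -/
def ElementShape.shapeFun {ν : ℕ} : ElementShape → Finset (Fin ν) → Pt ν → ℝ
  | simplex, s, x => if s = ∅ then 1 - ∑ j, x j else ∑ j ∈ s, x j
  | cube, s, x => ∏ j, if j ∈ s then x j else 1 - x j

/-- The facets of the reference element, each given by the set of labels of its vertices. -/
def ElementShape.facets (ν : ℕ) : ElementShape → Set (Finset (Finset (Fin ν)))
  | simplex => {f | ∃ s ∈ labels ν simplex, f = (labels ν simplex).erase s}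
  | cube => {f | ∃ j : Fin ν, f = Finset.univ.filter (fun s => j ∈ s) ∨
      f = Finset.univ.filter (fun s => j ∉ s)}

/-- The data of a mesh: finitely many affine images of reference elements. -/
structure Mesh (ν : ℕ) where
  numElem : ℕ
  shape : Fin numElem → ElementShape
  map : Fin numElem → (Pt ν ≃ᵃ[ℝ] Pt ν)

namespace Mesh

variable {ν : ℕ} (M : Mesh ν)

/-- The vertex with label `s` of element `e`. -/
def vertex (e : Fin M.numElem) (s : Finset (Fin ν)) : Pt ν := M.map e (refVertex s)

/-- The (closed) element `e`. -/
def elem (e : Fin M.numElem) : Set (Pt ν) :=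
  convexHull ℝ (M.vertex e '' ((M.shape e).labels ν : Set (Finset (Fin ν))))

/-- All nodes (element vertices) of the mesh. -/
def nodes : Set (Pt ν) :=
  {p | ∃ e, ∃ s ∈ (M.shape e).labels ν, p = M.vertex e s}

theorem finite_nodes : M.nodes.Finite := by
  have h : M.nodes = ⋃ e, M.vertex e '' ((M.shape e).labels ν : Set (Finset (Fin ν))) := by
    ext p
    simp only [nodes, mem_ofPred_eq, mem_iUnion, mem_image, Finset.mem_coe, eq_comm]
  rw [h]
  exact Set.finite_iUnion fun e => ((M.shape e).labels ν).finite_toSet.image _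

/-- All facets ((ν-1)-dimensional faces) of the elements of the mesh. -/
def facets : Set (Set (Pt ν)) :=
  {F | ∃ e, ∃ f ∈ (M.shape e).facets ν,
    F = convexHull ℝ (M.vertex e '' (f : Set (Finset (Fin ν))))}

/-- `M` is a geometrically conforming partition of `Ω`: the elements cover the closure of `Ω`,
distinct elements have disjoint interiors, and any two elements meet in a common (possibly
empty) face, that is, their intersection is an extreme subset of each of them. -/
structure IsPartition (Ω : Set (Pt ν)) : Prop where
  cover : (⋃ e, M.elem e) = closure Ω
  disjoint : Pairwise fun e e' => Disjoint (interior (M.elem e)) (interior (M.elem e'))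
  face : ∀ e e', IsExtreme ℝ (M.elem e) (M.elem e ∩ M.elem e')

/-- The mesh parameter `h`: the largest element diameter. -/
def meshSize : ℝ := ⨆ e, Metric.diam (M.elem e)

/-- Quasi-uniformity with constants `σ` (shape regularity: every element contains a ball whose
radius is at least `1 / σ` times the diameter of the element) and `τ` (all elements have diameter
at least `h / τ`). -/
structure QuasiUniform (σ τ : ℝ) : Prop where
  shapeRegular : ∀ e, ∃ c : Pt ν, ∃ r : ℝ, 0 < r ∧ Metric.closedBall c r ⊆ M.elem e ∧
    Metric.diam (M.elem e) ≤ σ * r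
  uniform : ∀ e, M.meshSize ≤ τ * Metric.diam (M.elem e)

/-- The facets of the mesh that lie on `γ`: the partition of `γ` induced by the mesh. -/
def facetsOn (γ : Set (Pt ν)) : Set (Set (Pt ν)) := {F | F ∈ M.facets ∧ F ⊆ γ}

/-- The characteristic size of the interface mesh: the largest diameter of a facet on `γ`. -/
def interfaceSize (γ : Set (Pt ν)) : ℝ := sSup (Metric.diam '' M.facetsOn γ)

/-- The interpolant of the nodal values `c` on the element `e`. -/
def localInterp (e : Fin M.numElem) (c : Pt ν → ℝ) (x : Pt ν) : ℝ :=
  ∑ s ∈ (M.shape e).labels ν, c (M.vertex e s) * (M.shape e).shapeFun s ((M.map e).symm x)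

open Classical in
/-- The nodal interpolant of `c`. On a conforming mesh the local interpolants of all elements
that contain `x` agree at `x`, and this is their common value; it is written as the mean over
the elements that contain `x`, and is `0` off the mesh. -/
def interp (c : Pt ν → ℝ) (x : Pt ν) : ℝ :=
  (∑ e, if x ∈ M.elem e then M.localInterp e c x else 0) /
    (∑ e, if x ∈ M.elem e then (1 : ℝ) else 0)

open Classical in
/-- The Lagrange (nodal) basis function of the node `p`. -/
def nodal (p : Pt ν) : Pt ν → ℝ := M.interp (Pi.single p 1)

/-- Interface nodes: the nodes on `γ` that do not lie on (the closure of) the Dirichlet boundary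
`Γ = ∂Ω \ γ`. -/
def interfaceNodes (Ω γ : Set (Pt ν)) : Set (Pt ν) :=
  {p ∈ M.nodes | p ∈ γ ∧ p ∉ closure (frontier Ω \ γ)}

/-- Interior nodes. -/
def interiorNodes (Ω : Set (Pt ν)) : Set (Pt ν) := {p ∈ M.nodes | p ∈ Ω}

end Mesh

/-! ### Two subdomains, their meshes and the finite element spaces -/

/-- Two disjoint subdomains `Ω 0`, `Ω 1` (called `Ω₁`, `Ω₂` in prose) with an interface `γ` in
their common boundary. Each is meshed independently; `γ` is a union of facets of either mesh, but
the two partitions of `γ` need not match. -/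
structure Decomposition (ν : ℕ) where
  Ω : Fin 2 → Set (Pt ν)
  γ : Set (Pt ν)
  mesh : Fin 2 → Mesh ν
  isOpen : ∀ i, IsOpen (Ω i)
  disjoint : Disjoint (Ω 0) (Ω 1)
  γ_subset : ∀ i, γ ⊆ frontier (Ω i)
  isPartition : ∀ i, (mesh i).IsPartition (Ω i)
  γ_eq : ∀ i, γ = ⋃₀ (mesh i).facetsOn γ

namespace Decomposition

variable {ν : ℕ} (D : Decomposition ν)

/-- Indices of the interface degrees of freedom of subdomain `i`. -/
abbrev INode (i : Fin 2) : Type := {p // p ∈ (D.mesh i).interfaceNodes (D.Ω i) D.γ}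

/-- Indices of the interior degrees of freedom of subdomain `i`. -/
abbrev ONode (i : Fin 2) : Type := {p // p ∈ (D.mesh i).interiorNodes (D.Ω i)}

instance (i : Fin 2) : Fintype (D.INode i) :=
  Set.Finite.fintype ((D.mesh i).finite_nodes.subset (Set.sep_subset _ _))

instance (i : Fin 2) : Fintype (D.ONode i) :=
  Set.Finite.fintype ((D.mesh i).finite_nodes.subset (Set.sep_subset _ _))

instance (i : Fin 2) : DecidableEq (D.INode i) := Classical.decEq _

instance (i : Fin 2) : DecidableEq (D.ONode i) := Classical.decEq _

/-- The finite element function on `Ω i` with interface coefficients `c` and zero interior and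
Dirichlet coefficients. -/
def interfaceFun (i : Fin 2) (c : D.INode i → ℝ) : Pt ν → ℝ :=
  ∑ p, c p • (D.mesh i).nodal (p : Pt ν)

/-- The finite element function on `Ω i` with interior coefficients `c` and zero interface and
Dirichlet coefficients. -/
def interiorFun (i : Fin 2) (c : D.ONode i → ℝ) : Pt ν → ℝ :=
  ∑ p, c p • (D.mesh i).nodal (p : Pt ν)

/-- The subspace `S̃_{i,γ}` spanned by the interface functions whose coefficient vectors are the
columns of `Φ`; it is the whole of `S_{i,γ}` for `Φ = 1`. -/
def interfaceSpace (i : Fin 2) {d : Type} (Φ : Matrix (D.INode i) d ℝ) :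
    Submodule ℝ (Pt ν → ℝ) :=
  Submodule.span ℝ (Set.range fun j => D.interfaceFun i (Φ.col j))

/-- The subspace `S̃_{i,0}` spanned by the interior functions whose coefficient vectors are the
columns of `Φ`; it is the whole of `S_{i,0}` for `Φ = 1`. -/
def interiorSpace (i : Fin 2) {d : Type} (Φ : Matrix (D.ONode i) d ℝ) :
    Submodule ℝ (Pt ν → ℝ) :=
  Submodule.span ℝ (Set.range fun j => D.interiorFun i (Φ.col j))

/-- The composite reduced basis space `S̃_{i,C} = S̃_{i,γ} ⊕ S̃_{i,0}`. -/
def compositeSpace (i : Fin 2) {d d' : Type} (Φγ : Matrix (D.INode i) d ℝ)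
    (Φ0 : Matrix (D.ONode i) d' ℝ) : Submodule ℝ (Pt ν → ℝ) :=
  D.interfaceSpace i Φγ ⊔ D.interiorSpace i Φ0

/-- The full order state space `S_{i,D}` (finite element functions vanishing on `Γ_i`). -/
def fullSpace (i : Fin 2) : Submodule ℝ (Pt ν → ℝ) :=
  D.compositeSpace i (1 : Matrix (D.INode i) (D.INode i) ℝ)
    (1 : Matrix (D.ONode i) (D.ONode i) ℝ)

/-- Restriction of functions to the interface. -/
def trace : (Pt ν → ℝ) →ₗ[ℝ] (D.γ → ℝ) := LinearMap.funLeft ℝ ℝ (Subtype.val : D.γ → Pt ν)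

/-- The reduced interface space `G̃_{i,γ}`: traces of the functions in `S̃_{i,γ}`. -/
def reducedTraceSpace (i : Fin 2) {d : Type} (Φ : Matrix (D.INode i) d ℝ) :
    Submodule ℝ (D.γ → ℝ) :=
  (D.interfaceSpace i Φ).map D.trace

/-- The interface finite element space `G_i`: traces of the functions in `S_{i,γ}`. -/
def traceSpace (i : Fin 2) : Submodule ℝ (D.γ → ℝ) :=
  D.reducedTraceSpace i (1 : Matrix (D.INode i) (D.INode i) ℝ)

/-! ### Inner products, norms and the constraint form -/

/-- The `L²(Ω_i)` inner product. -/
def innerΩ (i : Fin 2) (u v : Pt ν → ℝ) : ℝ := ∫ x in D.Ω i, u x * v x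

/-- The `L²(γ)` inner product, with respect to the surface measure. -/
def innerγ (l m : D.γ → ℝ) : ℝ :=
  ∫ x, l x * m x ∂((μHE[ν - 1] : Measure (Pt ν)).comap (Subtype.val : D.γ → Pt ν))

/-- The norm `‖{v₁, v₂}‖_V`. -/
def normV (v : (Pt ν → ℝ) × (Pt ν → ℝ)) : ℝ :=
  Real.sqrt (D.innerΩ 0 v.1 v.1 + D.innerΩ 1 v.2 v.2)

/-- The norm `‖μ‖_W`. -/
def normW (m : D.γ → ℝ) : ℝ := Real.sqrt (D.innerγ m m)

/-- The constraint form `b(v₁, v₂; μ) = (v₁ - v₂, μ)_{0,γ}`. -/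
def b (v : (Pt ν → ℝ) × (Pt ν → ℝ)) (m : D.γ → ℝ) : ℝ :=
  D.innerγ (D.trace v.1 - D.trace v.2) m

/-- The inf-sup condition for `b` on `(V₁ × V₂) × W` with constant `β`. The supremum is taken in
the extended reals; `v = 0` contributes the value `0 / 0 = 0`, so nothing but the convention for
`V₁ × V₂ = 0` depends on it. -/
def InfSup (V₁ V₂ : Submodule ℝ (Pt ν → ℝ)) (W : Submodule ℝ (D.γ → ℝ)) (β : ℝ) : Prop :=
  ∀ m ∈ W, ((β * D.normW m : ℝ) : EReal) ≤
    ⨆ v ∈ V₁.prod V₂, ((D.b v m / D.normV v : ℝ) : EReal)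

/-- The two inequalities for the lifting operator `Q`, with the mesh size `h`. -/
def LiftingBounds {V : Submodule ℝ ((Pt ν → ℝ) × (Pt ν → ℝ))} {W : Submodule ℝ (D.γ → ℝ)}
    (Q : W →ₗ[ℝ] V) (C₁ C₂ h : ℝ) : Prop :=
  ∀ m : W, D.normW m ^ 2 ≤ C₁ * D.b (Q m) m ∧
    D.normV (Q m) ≤ C₂ * h ^ (1 / 2 : ℝ) * D.normW m

/-! ### Matrices -/

/-- The block `M_{i,γγ}` of the mass matrix. -/
def massγγ (i : Fin 2) : Matrix (D.INode i) (D.INode i) ℝ :=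
  Matrix.of fun p q => D.innerΩ i ((D.mesh i).nodal p) ((D.mesh i).nodal q)

/-- The block `M_{i,γ0}` of the mass matrix. -/
def massγ0 (i : Fin 2) : Matrix (D.INode i) (D.ONode i) ℝ :=
  Matrix.of fun p q => D.innerΩ i ((D.mesh i).nodal p) ((D.mesh i).nodal q)

/-- The block `M_{i,0γ}` of the mass matrix. -/
def mass0γ (i : Fin 2) : Matrix (D.ONode i) (D.INode i) ℝ :=
  Matrix.of fun p q => D.innerΩ i ((D.mesh i).nodal p) ((D.mesh i).nodal q)

/-- The block `M_{i,00}` of the mass matrix. -/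
def mass00 (i : Fin 2) : Matrix (D.ONode i) (D.ONode i) ℝ :=
  Matrix.of fun p q => D.innerΩ i ((D.mesh i).nodal p) ((D.mesh i).nodal q)

/-- The full order mass matrix `M_{i,D}`. -/
def fullMass (i : Fin 2) : Matrix (D.INode i ⊕ D.ONode i) (D.INode i ⊕ D.ONode i) ℝ :=
  Matrix.fromBlocks (D.massγγ i) (D.massγ0 i) (D.mass0γ i) (D.mass00 i)

/-- The projected mass matrix `M̃_i` with the blocks `Φ_{i,p}ᵀ M_{i,pq} Φ_{i,q}`. -/
def reducedMass (i : Fin 2) {d d' : Type} (Φγ : Matrix (D.INode i) d ℝ)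
    (Φ0 : Matrix (D.ONode i) d' ℝ) : Matrix (d ⊕ d') (d ⊕ d') ℝ :=
  Matrix.fromBlocks (Φγᵀ * D.massγγ i * Φγ) (Φγᵀ * D.massγ0 i * Φ0)
    (Φ0ᵀ * D.mass0γ i * Φγ) (Φ0ᵀ * D.mass00 i * Φ0)

/-- The constraint matrix `G_{i,γ}` when the Lagrange multiplier space is `G_k`: its entries are
the `L²(γ)` inner products of the interface basis functions of the sides `k` and `i`. -/
def constraint (k i : Fin 2) : Matrix (D.INode k) (D.INode i) ℝ :=
  Matrix.of fun p q =>
    D.innerγ (D.trace ((D.mesh k).nodal p)) (D.trace ((D.mesh i).nodal q))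

variable {d d' : Type} [Fintype d] [DecidableEq d] [Fintype d'] [DecidableEq d']

/-- The Schur complement `Ŝ` of the coupled ROM-FOM problem, option rLM:
`Ĝ₁ = [Φᵀ G_{1,γ} Φ, 0]` and `Ĝ₂ = [Φᵀ G_{2,γ}, 0]` with `Φ = Φ_{1,γ}`. -/
def schurRLM (Φγ : Matrix (D.INode 0) d ℝ) (Φ0 : Matrix (D.ONode 0) d' ℝ) : Matrix d d ℝ :=
  let G₁ : Matrix d (d ⊕ d') ℝ := Matrix.fromCols (Φγᵀ * D.constraint 0 0 * Φγ) 0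
  let G₂ : Matrix d (D.INode 1 ⊕ D.ONode 1) ℝ := Matrix.fromCols (Φγᵀ * D.constraint 0 1) 0
  G₁ * (D.reducedMass 0 Φγ Φ0)⁻¹ * G₁ᵀ + G₂ * (D.fullMass 1)⁻¹ * G₂ᵀ

/-- The Schur complement `Ŝ` of the coupled ROM-FOM problem, option fLM:
`Ĝ₁ = [G_{1,γ} Φ, 0]` and `Ĝ₂ = [G_{2,γ}, 0]` with `Φ = Φ_{1,γ}`. -/
def schurFLM (Φγ : Matrix (D.INode 0) d ℝ) (Φ0 : Matrix (D.ONode 0) d' ℝ) :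
    Matrix (D.INode 1) (D.INode 1) ℝ :=
  let G₁ : Matrix (D.INode 1) (d ⊕ d') ℝ := Matrix.fromCols (D.constraint 1 0 * Φγ) 0
  let G₂ : Matrix (D.INode 1) (D.INode 1 ⊕ D.ONode 1) ℝ := Matrix.fromCols (D.constraint 1 1) 0
  G₁ * (D.reducedMass 0 Φγ Φ0)⁻¹ * G₁ᵀ + G₂ * (D.fullMass 1)⁻¹ * G₂ᵀ

end Decomposition

end RomFom

end

namespace RomFom

variable {ν : ℕ}

/-! ### Reference elements -/

/-! Everything rests on one estimate, `exists_lifting_bound`. If u is a finite element function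
whose nonzero coefficients all sit at interface nodes, then ‖u‖²_{0,Ω_i} ≤ C h_{i,γ} ‖u‖²_{0,γ} with
C depending only on ν, σ, τ, and the norm on γ is positive unless u has zero coefficients. Hence the
trace determines the coefficients, so lifting μ by its own coefficients is a well defined linear
map. With the sign built into `inject`, b(Qμ; μ) = ‖μ‖²_W exactly, and testing with v = Qμ gives the
inf-sup bound. Reduced bases do not affect the constants: the estimate holds for every coefficient
vector, and the lifting of a reduced multiplier stays in the reduced interface space.

Both sides of the estimate are compared with the sum of squared nodal values. From above, Jensen's
inequality (`interp_sq_le`) and the support of a basis function in a ball of radius h give a factor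
h^ν. From below (`sum_sq_le_integral_γ`), every interface node lies on a facet in γ; shrinking this
facet by 1/12 towards its vertex with the largest nodal value gives a region where |u| is at least
half that value. Such regions have area at least a constant times h^(ν-1), and almost every point of
γ lies in at most 2^ν of them. The quotient is one power of h, which is at most a multiple of
h_{i,γ}.

Since `interp` is a mean over the elements containing a point, the lower bound needs almost every
point of γ to lie in a single element (`ae_unique_elem`). Two elements sharing a relative interior
point of a facet would fill a neighbourhood of it (`mem_interior_union_of_mem_intrinsicInterior`),
but the other subdomain accumulates at every point of γ. Continuity of `interp` across elements is
never needed.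

The mass matrices are Gram matrices of independent functions. In the Schur complement, the
multiplier side contributes a positive definite term and the other side a positive semidefinite one.
-/

@[simp]
theorem refVertex_apply (s : Finset (Fin ν)) (j : Fin ν) :
    (refVertex s : Pt ν) j = if j ∈ s then 1 else 0 := rfl

theorem one_le_dist_refVertex {s t : Finset (Fin ν)} (h : s ≠ t) :
    1 ≤ dist (refVertex s : Pt ν) (refVertex t) := by
  obtain ⟨j, hj⟩ : ∃ j, ¬ (j ∈ s ↔ j ∈ t) := by
    by_contra! hc
    exact h (Finset.ext hc)
  have h1 := PiLp.norm_apply_le (refVertex s - refVertex t : Pt ν) j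
  rw [dist_eq_norm]
  refine le_trans (le_of_eq ?_) h1
  by_cases hs : j ∈ s <;> by_cases ht : j ∈ t <;> simp_all

/-- The closed reference element. -/
def ElementShape.refElem (ν : ℕ) (S : ElementShape) : Set (Pt ν) :=
  convexHull ℝ (refVertex '' (S.labels ν : Set (Finset (Fin ν))))

theorem mem_labels_simplex {s : Finset (Fin ν)} :
    s ∈ ElementShape.labels ν .simplex ↔ s = ∅ ∨ ∃ j, s = {j} := by
  rw [ElementShape.labels, Finset.mem_filter, Nat.le_one_iff_eq_zero_or_eq_one,
    Finset.card_eq_zero, Finset.card_eq_one]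
  simp

theorem shapeFun_simplex (s : Finset (Fin ν)) (x : Pt ν) :
    ElementShape.simplex.shapeFun s x = if s = ∅ then 1 - ∑ j, x j else ∑ j ∈ s, x j := rfl

theorem shapeFun_cube (s : Finset (Fin ν)) (x : Pt ν) :
    ElementShape.cube.shapeFun s x = ∏ j, if j ∈ s then x j else 1 - x j := rfl

theorem convex_unitCube : Convex ℝ {x : Pt ν | ∀ j, 0 ≤ x j ∧ x j ≤ 1} := by
  intro x hx y hy a b ha hb hab j
  obtain ⟨h1, h2⟩ := hx j
  obtain ⟨h3, h4⟩ := hy j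
  simp only [PiLp.add_apply, PiLp.smul_apply, smul_eq_mul]
  constructor
  · positivity
  · nlinarith

theorem ElementShape.refElem_subset_cube (S : ElementShape) :
    S.refElem ν ⊆ {x | ∀ j, 0 ≤ x j ∧ x j ≤ 1} := by
  refine convexHull_min ?_ convex_unitCube
  rintro _ ⟨s, -, rfl⟩ j
  by_cases h : j ∈ s <;> simp [h]

theorem ElementShape.sum_le_one {x : Pt ν} (hx : x ∈ ElementShape.refElem ν .simplex) :
    ∑ j, x j ≤ 1 := by
  have hc : Convex ℝ {x : Pt ν | ∑ j, x j ≤ 1} := by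
    intro x hx y hy a b ha hb hab
    simp only [mem_ofPred_eq, PiLp.add_apply, PiLp.smul_apply, smul_eq_mul, Finset.sum_add_distrib,
      ← Finset.mul_sum] at *
    nlinarith
  refine convexHull_min ?_ hc hx
  rintro _ ⟨s, hs, rfl⟩
  rcases mem_labels_simplex.1 hs with rfl | ⟨j, rfl⟩ <;> simp

theorem ElementShape.shapeFun_nonneg (S : ElementShape) (s : Finset (Fin ν)) {x : Pt ν}
    (hx : x ∈ S.refElem ν) : 0 ≤ S.shapeFun s x := by
  have h := S.refElem_subset_cube hx
  cases S with
  | simplex =>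
    simp only [shapeFun]
    split_ifs
    · linarith [sum_le_one hx]
    · exact Finset.sum_nonneg fun j _ => (h j).1
  | cube =>
    refine Finset.prod_nonneg fun j _ => ?_
    split_ifs
    · exact (h j).1
    · linarith [(h j).2]

theorem labels_simplex_eq :
    ElementShape.labels ν .simplex = insert ∅ (Finset.univ.image fun j : Fin ν => {j}) := by
  ext s
  rw [mem_labels_simplex]
  simp [eq_comm]

/-- Partition of unity. On the cube it is the expansion of ∏ (x_j + (1 - x_j)) = 1 over subsets. -/
theorem ElementShape.sum_shapeFun (S : ElementShape) (x : Pt ν) :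
    ∑ s ∈ S.labels ν, S.shapeFun s x = 1 := by
  cases S with
  | simplex =>
    rw [labels_simplex_eq, Finset.sum_insert (by simp),
      Finset.sum_image fun a _ b _ h => Finset.singleton_injective h]
    simp [shapeFun]
  | cube =>
    have h := Finset.prod_add (fun j => x j) (fun j => 1 - x j) Finset.univ
    simp only [add_sub_cancel, Finset.prod_const_one, Finset.powerset_univ] at h
    rw [h, labels]
    refine Finset.sum_congr rfl fun s _ => ?_
    rw [shapeFun_cube, Finset.prod_ite]
    congr 1
    · exact Finset.prod_congr (by ext; simp) fun _ _ => rfl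
    · exact Finset.prod_congr (by ext; simp) fun _ _ => rfl

theorem ElementShape.continuous_shapeFun (S : ElementShape) (s : Finset (Fin ν)) :
    Continuous (S.shapeFun s : Pt ν → ℝ) := by
  cases S with
  | simplex =>
    have h : (simplex.shapeFun s : Pt ν → ℝ) =
        fun x => if s = ∅ then 1 - ∑ j, x j else ∑ j ∈ s, x j := rfl
    rw [h]
    split_ifs <;> fun_prop
  | cube =>
    refine continuous_finsetProd _ fun j _ => ?_
    split_ifs <;> fun_prop

/-- Near its own vertex a shape function is close to one. -/
theorem ElementShape.le_shapeFun_near_vertex (S : ElementShape) (hν : 0 < ν) {s : Finset (Fin ν)}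
    (hs : s ∈ S.labels ν) {x : Pt ν} (hx : x ∈ S.refElem ν) {t : ℝ} (ht : 0 ≤ t) (ht' : t ≤ 1) :
    1 - ν * t ≤ S.shapeFun s (AffineMap.homothety (refVertex s) t x) := by
  have h := S.refElem_subset_cube hx
  have hν' : (1 : ℝ) ≤ ν := by exact_mod_cast hν
  have key : ∀ j, (AffineMap.homothety (refVertex s) t x : Pt ν) j
      = t * (x j - if j ∈ s then 1 else 0) + if j ∈ s then 1 else 0 := by
    intro j
    simp [AffineMap.homothety_apply]
  cases S with
  | simplex =>
    have h1 : 1 - t ≤ ElementShape.simplex.shapeFun s (AffineMap.homothety (refVertex s) t x) := by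
      rcases mem_labels_simplex.1 hs with rfl | ⟨j, rfl⟩
      · have := sum_le_one hx
        simp only [shapeFun_simplex, if_true, key, Finset.notMem_empty, if_false, sub_zero, add_zero,
          ← Finset.mul_sum]
        nlinarith
      · have := (h j).1
        simp only [shapeFun_simplex, Finset.singleton_ne_empty, if_false, key, Finset.sum_singleton,
          Finset.mem_singleton, if_true]
        nlinarith
    nlinarith
  | cube =>
    have h1 : (1 - t) ^ ν ≤ ElementShape.cube.shapeFun s (AffineMap.homothety (refVertex s) t x) := by
      have : (1 - t) ^ ν = ∏ _j : Fin ν, (1 - t) := by simp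
      rw [this]
      refine Finset.prod_le_prod (fun _ _ => by linarith) fun j _ => ?_
      obtain ⟨h2, h3⟩ := h j
      rw [key]
      split_ifs <;> nlinarith
    -- Bernoulli's inequality for (1 - t)^ν.
    have h2 := one_add_mul_le_pow (a := -t) (by linarith) ν
    have h3 : 1 + -t = 1 - t := by ring
    rw [h3] at h2
    linarith

theorem ElementShape.facets_finite (S : ElementShape) : (S.facets ν).Finite := Set.toFinite _

/-- Used with g k a difference of two facet vertices; the alternative w k = 0 absorbs the coordinate
normal to the facet, where no such difference is available. -/
theorem sum_coord_smul_mem (V : Submodule ℝ (Pt ν)) (w : Pt ν) (g : Fin ν → Pt ν)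
    (hw : w = ∑ k, w k • g k) (hg : ∀ k, w k = 0 ∨ g k ∈ V) : w ∈ V := by
  rw [hw]
  refine Submodule.sum_mem _ fun k _ => ?_
  rcases hg k with h | h
  · simp [h]
  · exact V.smul_mem _ h

/-- Every facet of a reference element is cut out by an affine function that is nonnegative on the
element and whose zero set is the affine span of the facet. -/
theorem ElementShape.exists_facet_function (S : ElementShape) {f : Finset (Finset (Fin ν))}
    (hf : f ∈ S.facets ν) : f ⊆ S.labels ν ∧ ∃ ℓ : Pt ν →ᵃ[ℝ] ℝ,
      (∀ s ∈ S.labels ν, 0 ≤ ℓ (refVertex s)) ∧ (∀ s ∈ f, ℓ (refVertex s) = 0) ∧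
      (∃ s ∈ S.labels ν, 0 < ℓ (refVertex s)) ∧
      (∀ s ∈ S.labels ν, s ∉ f → ∀ x, ℓ x = 0 → S.shapeFun s x = 0) ∧
      ∀ w, ℓ.linear w = 0 → w ∈ vectorSpan ℝ ((refVertex : _ → Pt ν) '' (f : Set (Finset (Fin ν)))) := by
  classical
  let π (j : Fin ν) : Pt ν →ₗ[ℝ] ℝ := (EuclideanSpace.proj (𝕜 := ℝ) j : Pt ν →L[ℝ] ℝ).toLinearMap
  have hπ : ∀ j x, π j x = x j := fun _ _ => rfl
  have hdiff : ∀ {s t : Finset (Fin ν)}, s ∈ f → t ∈ f → (refVertex s - refVertex t : Pt ν) ∈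
      vectorSpan ℝ ((refVertex : _ → Pt ν) '' (f : Set (Finset (Fin ν)))) := fun hs ht =>
    vsub_mem_vectorSpan ℝ (mem_image_of_mem _ hs) (mem_image_of_mem _ ht)
  cases S with
  | simplex =>
    obtain ⟨s, hs, rfl⟩ := hf
    refine ⟨Finset.erase_subset _ _, ?_⟩
    rcases mem_labels_simplex.1 hs with rfl | ⟨j, rfl⟩
    -- The facet opposite the origin is cut out by 1 - ∑ x_j, the barycentric coordinate of the
    -- omitted vertex.
    · refine ⟨AffineMap.const ℝ _ 1 - (∑ j, π j).toAffineMap, ?_, ?_, ⟨∅, hs, ?_⟩, ?_, ?_⟩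
      · intro s hs
        rcases mem_labels_simplex.1 hs with rfl | ⟨j, rfl⟩ <;> simp [hπ]
      · intro s hs
        rw [Finset.mem_erase] at hs
        obtain rfl | ⟨j, rfl⟩ := mem_labels_simplex.1 hs.2
        · exact absurd rfl hs.1
        · simp [hπ]
      · simp [hπ]
      · intro s hs hsf x hx
        have : s = ∅ := by
          by_contra hne
          exact hsf (Finset.mem_erase.2 ⟨hne, hs⟩)
        subst this
        simpa [shapeFun_simplex, hπ] using hx
      · intro w hw
        have hsum : ∑ j, w j = 0 := by simpa [hπ] using hw
        rcases isEmpty_or_nonempty (Fin ν) with hE | ⟨⟨j⟩⟩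
        · have : w = 0 := by ext k; exact hE.elim k
          rw [this]; exact Submodule.zero_mem _
        -- The coordinates of w sum to zero, so w = ∑ w_k (e_k - e_j) for any fixed j.
        · refine sum_coord_smul_mem _ w (fun k => refVertex {k} - refVertex {j}) ?_ fun k =>
            Or.inr (hdiff (Finset.mem_erase.2 ⟨by simp, mem_labels_simplex.2 (Or.inr ⟨k, rfl⟩)⟩)
              (Finset.mem_erase.2 ⟨by simp, mem_labels_simplex.2 (Or.inr ⟨j, rfl⟩)⟩))
          ext i
          simp [mul_sub, Finset.sum_sub_distrib, hsum]
    · refine ⟨(π j).toAffineMap, ?_, ?_, ⟨{j}, hs, ?_⟩, ?_, ?_⟩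
      · intro s hs
        by_cases h : j ∈ s <;> simp [hπ, h]
      · intro s hs
        rw [Finset.mem_erase] at hs
        obtain rfl | ⟨k, rfl⟩ := mem_labels_simplex.1 hs.2
        · simp [hπ]
        · have : j ≠ k := fun h => hs.1 (by rw [h])
          simp [hπ, this]
      · simp [hπ]
      · intro s hs hsf x hx
        have : s = {j} := by
          by_contra hne
          exact hsf (Finset.mem_erase.2 ⟨hne, hs⟩)
        subst this
        simpa [shapeFun_simplex, hπ] using hx
      · intro w hw
        have hw : w j = 0 := by simpa [hπ] using hw
        refine sum_coord_smul_mem _ w (fun k => refVertex {k} - refVertex ∅) ?_ fun k => ?_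
        · ext i
          simp
        · by_cases hk : k = j
          · exact Or.inl (hk ▸ hw)
          · exact Or.inr (hdiff (Finset.mem_erase.2 ⟨by simpa using hk,
              mem_labels_simplex.2 (Or.inr ⟨k, rfl⟩)⟩)
              (Finset.mem_erase.2 ⟨(Finset.singleton_ne_empty j).symm,
                mem_labels_simplex.2 (Or.inl rfl)⟩))
  | cube =>
    obtain ⟨j, rfl | rfl⟩ := hf
    · refine ⟨Finset.subset_univ _, AffineMap.const ℝ _ 1 - (π j).toAffineMap, ?_, ?_,
        ⟨∅, Finset.mem_univ _, ?_⟩, ?_, ?_⟩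
      · intro s hs
        by_cases h : j ∈ s <;> simp [hπ, h]
      · intro s hs
        simp [hπ, (Finset.mem_filter.1 hs).2]
      · simp [hπ]
      · intro s hs hsf x hx
        have hj : j ∉ s := by simpa using hsf
        rw [shapeFun_cube]
        refine Finset.prod_eq_zero (Finset.mem_univ j) ?_
        simpa [hj, hπ] using hx
      · intro w hw
        have hw : w j = 0 := by simpa [hπ] using hw
        -- All labels must contain j to stay on the facet x_j = 1. The difference is e_k for k ≠ j
        -- and 0 for k = j, which is harmless as w_j = 0.
        refine sum_coord_smul_mem _ w (fun k => refVertex (insert j {k}) - refVertex {j}) ?_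
          fun k => Or.inr (hdiff (by simp) (by simp))
        ext i
        by_cases hi : i = j
        · simp [hi, hw]
        · simp [hi]
    · refine ⟨Finset.subset_univ _, (π j).toAffineMap, ?_, ?_,
        ⟨{j}, Finset.mem_univ _, ?_⟩, ?_, ?_⟩
      · intro s hs
        by_cases h : j ∈ s <;> simp [hπ, h]
      · intro s hs
        simp [hπ, (Finset.mem_filter.1 hs).2]
      · simp [hπ]
      · intro s hs hsf x hx
        have hj : j ∈ s := by simpa using hsf
        rw [shapeFun_cube]
        refine Finset.prod_eq_zero (Finset.mem_univ j) ?_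
        simpa [hj, hπ] using hx
      · intro w hw
        have hw : w j = 0 := by simpa [hπ] using hw
        refine sum_coord_smul_mem _ w (fun k => refVertex {k} - refVertex ∅) ?_ fun k => ?_
        · ext i
          simp
        · by_cases hk : k = j
          · exact Or.inl (hk ▸ hw)
          · exact Or.inr (hdiff (by simpa using Ne.symm hk) (by simp))

end RomFom

namespace RomFom

open scoped Topology
open Filter

/-! ### Convex bodies sharing a facet, and Hausdorff measure of convex sets -/

section Convex

variable {V : Type*} [NormedAddCommGroup V] [InnerProductSpace ℝ V]

theorem exists_ball_of_mem_intrinsicInterior {F : Set V} {x : V} (hx : x ∈ intrinsicInterior ℝ F) :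
    ∃ ε > 0, ∀ y ∈ affineSpan ℝ F, dist y x < ε → y ∈ F := by
  obtain ⟨x', hx', rfl⟩ := mem_intrinsicInterior.1 hx
  obtain ⟨ε, hε, h⟩ := Metric.mem_nhds_iff.1 (mem_interior_iff_mem_nhds.1 hx')
  exact ⟨ε, hε, fun y hy hd => h (show (⟨y, hy⟩ : affineSpan ℝ F) ∈ Metric.ball x' ε from hd)⟩

/-- Moving from z a little in the direction y - x increases ℓ. -/
theorem frequently_pos_of_eq_zero (ℓ : V →ᵃ[ℝ] ℝ) {x y z : V} (hx : ℓ x = 0) (hy : 0 < ℓ y)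
    (hz : ℓ z = 0) : ∃ᶠ w in 𝓝 z, 0 < ℓ w := by
  have h1 : Tendsto (fun δ : ℝ => δ • (y - x) + z) (𝓝[>] 0) (𝓝 z) := by
    have : Continuous fun δ : ℝ => δ • (y - x) + z := by fun_prop
    have h := this.tendsto 0
    simp only [zero_smul, zero_add] at h
    exact h.mono_left nhdsWithin_le_nhds
  refine h1.frequently (Eventually.frequently ?_)
  filter_upwards [self_mem_nhdsWithin] with δ hδ
  have : ℓ (δ • (y - x) + z) = δ * (ℓ y - ℓ x) + ℓ z := by
    rw [← vadd_eq_add, ℓ.map_vadd, map_smul, ← vsub_eq_sub, ℓ.linearMap_vsub]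
    rfl
  rw [this, hx, hz]
  have : 0 < δ := hδ
  simp; positivity

variable [FiniteDimensional ℝ V]

/-- A convex set that lies on a hyperplane facet and has a point on the positive side contains a
half ball around each relative interior point of that facet. -/
theorem eventually_mem_of_nonneg {K F : Set V} (hK : Convex ℝ K) (hFK : F ⊆ K) (ℓ : V →ᵃ[ℝ] ℝ)
    (hF : ∀ z, ℓ z = 0 → z ∈ affineSpan ℝ F) {x y : V} (hx : x ∈ intrinsicInterior ℝ F)
    (hx0 : ℓ x = 0) (hy : y ∈ K) (hy0 : 0 < ℓ y) : ∀ᶠ z in 𝓝 x, 0 ≤ ℓ z → z ∈ K := by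
  obtain ⟨ε, hε, hball⟩ := exists_ball_of_mem_intrinsicInterior hx
  have hℓ : Continuous ℓ := ℓ.continuous_of_finiteDimensional
  let t : V → ℝ := fun z => ℓ z / ℓ y
  have ht : Continuous t := hℓ.div_const _
  have htx : t x = 0 := by simp [t, hx0]
  -- Central projection from y onto the hyperplane ℓ = 0, so that z = t y + (1 - t) w. It is
  -- continuous at x and fixes x, so for z near x the point w lies in F; if also ℓ z ≥ 0, then z is
  -- a convex combination of points of K.
  let w : V → V := fun z => (1 - t z)⁻¹ • (z - t z • y)
  have hw : ContinuousAt w x := by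
    refine ContinuousAt.smul (ContinuousAt.inv₀ (by fun_prop) (by simp [htx])) (by fun_prop)
  have hwx : w x = x := by simp [w, htx]
  have h1 : ∀ᶠ z in 𝓝 x, t z < 1 := ht.continuousAt.eventually_lt_const (by simp [htx])
  have h2 : ∀ᶠ z in 𝓝 x, dist (w z) x < ε := by
    have := hw.eventually (Metric.ball_mem_nhds (w x) hε)
    rwa [hwx] at this
  filter_upwards [h1, h2] with z hz1 hz2 hz3
  have hne : 1 - t z ≠ 0 := by linarith
  have hz : z = t z • y + (1 - t z) • w z := by
    simp only [w, smul_smul, mul_inv_cancel₀ hne, one_smul]; abel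
  have hℓz : ℓ z = t z * ℓ y + (1 - t z) * ℓ (w z) := by
    conv_lhs => rw [hz]
    rw [Convex.combo_affine_apply (by ring)]
    rfl
  have hw0 : ℓ (w z) = 0 := by
    have : t z * ℓ y = ℓ z := div_mul_cancel₀ _ hy0.ne'
    have : (1 - t z) * ℓ (w z) = 0 := by linarith
    exact (mul_eq_zero.1 this).resolve_left hne
  rw [hz]
  exact hK hy (hFK (hball _ (hF _ hw0) hz2)) (div_nonneg hz3 hy0.le) (by linarith) (by ring)

/-- If two nonoverlapping convex bodies share a relative interior point of a facet of the first,
and their intersection is a face of the first, then that point is interior to their union. -/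
theorem mem_interior_union_of_mem_intrinsicInterior {K K' F : Set V} (hK : Convex ℝ K)
    (hK' : Convex ℝ K') (hint : (interior K').Nonempty)
    (hdisj : Disjoint (interior K) (interior K')) (hext : IsExtreme ℝ K (K ∩ K')) (hFK : F ⊆ K)
    (ℓ : V →ᵃ[ℝ] ℝ) (hF0 : ∀ z ∈ F, ℓ z = 0) (hF : ∀ z, ℓ z = 0 → z ∈ affineSpan ℝ F) {x y : V}
    (hx : x ∈ intrinsicInterior ℝ F) (hxK' : x ∈ K') (hy : y ∈ K) (hy0 : 0 < ℓ y) :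
    x ∈ interior (K ∪ K') := by
  have hxF : x ∈ F := intrinsicInterior_subset hx
  have hx0 : ℓ x = 0 := hF0 x hxF
  -- For z in F, the segment from z to x can be prolonged slightly beyond x inside F. Then x is an
  -- interior point of a segment in K and belongs to the face K ∩ K', so the endpoint z does too.
  have hFK' : F ⊆ K' := by
    obtain ⟨ε, hε, hball⟩ := exists_ball_of_mem_intrinsicInterior hx
    intro z hz
    obtain ⟨δ, hδ, hδ'⟩ : ∃ δ : ℝ, 0 < δ ∧ δ * ‖x - z‖ < ε := by
      refine ⟨ε / (‖x - z‖ + 1), by positivity, ?_⟩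
      rw [div_mul_eq_mul_div, div_lt_iff₀ (by positivity)]
      nlinarith [norm_nonneg (x - z)]
    have hw : δ • (x - z) + x ∈ F := by
      refine hball _ ?_ ?_
      · exact AffineSubspace.vadd_mem_of_mem_direction
          ((affineSpan ℝ F).direction.smul_mem δ (AffineSubspace.vsub_mem_direction
            (subset_affineSpan ℝ F hxF) (subset_affineSpan ℝ F hz))) (subset_affineSpan ℝ F hxF)
      · rw [dist_eq_norm, add_sub_cancel_right, norm_smul, Real.norm_of_nonneg hδ.le]
        exact hδ'
    refine (hext.left_mem_of_mem_openSegment (hFK hz) (hFK hw) ⟨hFK hxF, hxK'⟩ ?_).2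
    have h1 : (1 + δ)⁻¹ * (1 + δ) = 1 := inv_mul_cancel₀ (by positivity)
    refine ⟨δ * (1 + δ)⁻¹, (1 + δ)⁻¹, by positivity, by positivity, by linarith, ?_⟩
    calc (δ * (1 + δ)⁻¹) • z + (1 + δ)⁻¹ • (δ • (x - z) + x)
        = ((1 + δ)⁻¹ * (1 + δ)) • x := by module
      _ = x := by rw [h1, one_smul]
  have hKx := eventually_mem_of_nonneg hK hFK ℓ hF hx hx0 hy hy0
  -- A point of K' on the positive side would give K' a half ball at x on the same side as that of
  -- K, and the interiors would meet.
  have hneg : ∀ z ∈ K', ℓ z ≤ 0 := by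
    intro z hz
    by_contra! hz0
    have hK'x := eventually_mem_of_nonneg hK' hFK' ℓ hF hx hx0 hz hz0
    obtain ⟨w, hw0, hw1, hw2⟩ := ((frequently_pos_of_eq_zero ℓ hx0 hy0 hx0).and_eventually
      ((eventually_eventually_nhds.2 hKx).and (eventually_eventually_nhds.2 hK'x))).exists
    have hpos : ∀ᶠ u in 𝓝 w, 0 < ℓ u :=
      (ℓ.continuous_of_finiteDimensional).continuousAt.eventually_const_lt hw0
    refine Set.disjoint_left.1 hdisj (?_ : w ∈ _) ?_
    · exact mem_interior_iff_mem_nhds.2 (by filter_upwards [hpos, hw1] with u h1 h2 using h2 h1.le)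
    · exact mem_interior_iff_mem_nhds.2 (by filter_upwards [hpos, hw2] with u h1 h2 using h2 h1.le)
  -- K' has interior points, so it is not contained in the hyperplane; it therefore contains the
  -- opposite half ball.
  obtain ⟨z, hz, hz0⟩ : ∃ z ∈ K', ℓ z < 0 := by
    obtain ⟨z, hz⟩ := hint
    refine ⟨z, interior_subset hz, lt_of_le_of_ne (hneg z (interior_subset hz)) fun h0 => ?_⟩
    obtain ⟨w, hw, hw'⟩ := ((frequently_pos_of_eq_zero ℓ hx0 hy0 h0).and_eventually
      (mem_interior_iff_mem_nhds.1 hz)).exists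
    exact absurd (hneg w hw') (not_le.2 hw)
  have hK'x := eventually_mem_of_nonneg hK' hFK' (-ℓ) (fun z hz => hF z (by simpa using hz)) hx
    (by simpa using hx0) hz (by simpa using hz0)
  refine mem_interior_iff_mem_nhds.2 ?_
  filter_upwards [hKx, hK'x] with u h1 h2
  rcases le_total 0 (ℓ u) with h | h
  · exact Or.inl (h1 h)
  · exact Or.inr (h2 (by simpa using h))

variable [MeasurableSpace V] [BorelSpace V]

/-- The Hausdorff measure of a compact convex set in the dimension of its affine span. -/
theorem euclideanHausdorffMeasure_convex {F : Set V} (hF : Convex ℝ F) (hc : IsCompact F)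
    (hne : F.Nonempty) {n : ℕ} (hn : Module.finrank ℝ (vectorSpan ℝ F) = n) :
    μHE[n] F < ⊤ ∧ 0 < μHE[n] F ∧ μHE[n] (F \ intrinsicInterior ℝ F) = 0 := by
  obtain ⟨p, hp⟩ := hne
  let S := affineSpan ℝ F
  let p' : S := ⟨p, subset_affineSpan ℝ F hp⟩
  have : Nonempty S := ⟨p'⟩
  have hdir : Module.finrank ℝ S.direction = n := by rw [← hn, direction_affineSpan]
  -- Identifying the affine span with its direction turns the n-dimensional Hausdorff measure into
  -- Lebesgue measure, for which a convex set has null frontier.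
  let φ := IsometryEquiv.vaddConst (V := S.direction) p'
  have hφ : MeasurePreserving φ volume (μHE[n] : Measure S) := by
    rw [← hdir]
    exact EuclideanGeometry.measurePreserving_vaddConst p'
  have hmeas : ∀ T : Set S, μHE[n] ((↑) '' T : Set V) = volume (φ ⁻¹' T) := fun T => by
    rw [AffineSubspace.euclideanHausdorffMeasure_coe_image,
      hφ.measure_preimage_emb φ.toHomeomorph.measurableEmbedding]
  let T : Set S := (↑) ⁻¹' F
  have hT : ((↑) '' T : Set V) = F := by
    exact (Subtype.image_preimage_coe _ _).trans (inter_eq_right.2 (subset_affineSpan ℝ F))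
  have hmem : ∀ w, w ∈ φ ⁻¹' T ↔ (w : V) + p ∈ F := fun w => Iff.rfl
  have hconv : Convex ℝ (φ ⁻¹' T) := by
    intro a ha b hb s t hs ht hst
    rw [hmem] at *
    have := hF ha hb hs ht hst
    convert this using 1
    simp only [Submodule.coe_add, Submodule.coe_smul, smul_add]
    nth_rewrite 1 [← one_smul ℝ p]
    rw [← hst, add_smul]
    abel
  have hcpt : IsCompact (φ ⁻¹' T) := by
    have h1 : IsCompact T := by
      rw [Subtype.isCompact_iff, hT]
      exact hc
    exact φ.toHomeomorph.isCompact_preimage.2 h1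
  have hfr : φ ⁻¹' (T \ interior T) ⊆ frontier (φ ⁻¹' T) := by
    rw [preimage_sdiff]
    have : φ ⁻¹' (interior T) = interior (φ ⁻¹' T) := φ.toHomeomorph.preimage_interior T
    rw [this]
    exact sdiff_subset_sdiff_left subset_closure
  refine ⟨?_, ?_, ?_⟩
  · rw [← hT, hmeas]
    exact hcpt.measure_lt_top
  · have h1 : (interior (φ ⁻¹' T)).Nonempty := by
      obtain ⟨x, hx⟩ := Set.Nonempty.intrinsicInterior hF ⟨p, hp⟩
      obtain ⟨y, hy, -⟩ := mem_intrinsicInterior.1 hx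
      have : φ ⁻¹' (interior T) = interior (φ ⁻¹' T) := φ.toHomeomorph.preimage_interior T
      rw [← this]
      exact ⟨φ.symm y, by simpa using hy⟩
    rw [← hT, hmeas]
    exact Measure.measure_pos_of_nonempty_interior _ h1
  · have : F \ intrinsicInterior ℝ F = (↑) '' (T \ interior T) := by
      rw [image_sdiff Subtype.val_injective, hT]
      rfl
    rw [this, hmeas]
    exact measure_mono_null hfr (hconv.addHaar_frontier _)

end Convex

end RomFom

namespace RomFom

variable {ν : ℕ}

/-! ### Elements and facets of a mesh -/

namespace Mesh

variable (M : Mesh ν)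

theorem elem_eq (e : Fin M.numElem) : M.elem e = M.map e '' (M.shape e).refElem ν := by
  have h := (M.map e).toAffineMap.image_convexHull
    (refVertex '' ((M.shape e).labels ν : Set (Finset (Fin ν))))
  rw [image_image] at h
  exact h.symm

variable {M}

theorem mem_elem_iff {e : Fin M.numElem} {x : Pt ν} :
    x ∈ M.elem e ↔ (M.map e).symm x ∈ (M.shape e).refElem ν := by
  rw [elem_eq]
  constructor
  · rintro ⟨y, hy, rfl⟩
    simpa using hy
  · intro h
    exact ⟨_, h, by simp⟩

theorem symm_vertex (e : Fin M.numElem) (s : Finset (Fin ν)) :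
    (M.map e).symm (M.vertex e s) = refVertex s := by
  simp [vertex]

theorem isCompact_elem (e : Fin M.numElem) : IsCompact (M.elem e) :=
  Set.Finite.isCompact_convexHull ℝ (((M.shape e).labels ν).finite_toSet.image _)

theorem convex_elem (e : Fin M.numElem) : Convex ℝ (M.elem e) := convex_convexHull _ _

theorem vertex_mem_elem (e : Fin M.numElem) {s : Finset (Fin ν)} (hs : s ∈ (M.shape e).labels ν) :
    M.vertex e s ∈ M.elem e := subset_convexHull _ _ (mem_image_of_mem _ hs)

theorem vertex_injective (e : Fin M.numElem) : Function.Injective (M.vertex e) := by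
  intro s t h
  by_contra hne
  have h1 := one_le_dist_refVertex hne
  rw [(M.map e).injective h, dist_self] at h1
  linarith

theorem coord_mem (e : Fin M.numElem) {x : Pt ν} (hx : x ∈ M.elem e) (j : Fin ν) :
    0 ≤ (M.map e).symm x j ∧ (M.map e).symm x j ≤ 1 :=
  (M.shape e).refElem_subset_cube (mem_elem_iff.1 hx) j

/-- In reference coordinates both endpoints lie in the unit cube, and a combination with positive
weights takes the value 0 or 1 in a coordinate only if both endpoints do. -/
theorem vertex_mem_extremePoints (e : Fin M.numElem) {s : Finset (Fin ν)}
    (hs : s ∈ (M.shape e).labels ν) : M.vertex e s ∈ (M.elem e).extremePoints ℝ := by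
  refine mem_extremePoints_iff_left.2 ⟨vertex_mem_elem e hs, ?_⟩
  rintro x hx y hy ⟨a, b, ha, hb, hab, h⟩
  rw [← (M.map e).symm.injective.eq_iff, symm_vertex]
  have h2 : a • (M.map e).symm x + b • (M.map e).symm y = refVertex s := by
    have h3 := Convex.combo_affine_apply (f := (M.map e).symm.toAffineMap) (x := x) (y := y) hab
    rw [h] at h3
    exact (h3.symm.trans (symm_vertex e s))
  ext j
  have h3 : a * (M.map e).symm x j + b * (M.map e).symm y j = refVertex s j := by
    rw [← h2]; rfl
  obtain ⟨h4, h5⟩ := coord_mem e hx j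
  obtain ⟨h6, h7⟩ := coord_mem e hy j
  rw [refVertex_apply] at h3 ⊢
  split_ifs at h3 ⊢ <;> nlinarith

/-- The facet of the element `e` with the vertex labels `f`. -/
def facet (M : Mesh ν) (e : Fin M.numElem) (f : Finset (Finset (Fin ν))) : Set (Pt ν) :=
  convexHull ℝ (M.vertex e '' (f : Set (Finset (Fin ν))))

theorem isCompact_facet (e : Fin M.numElem) (f : Finset (Finset (Fin ν))) :
    IsCompact (M.facet e f) := Set.Finite.isCompact_convexHull ℝ (f.finite_toSet.image _)

theorem convex_facet (e : Fin M.numElem) (f : Finset (Finset (Fin ν))) : Convex ℝ (M.facet e f) :=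
  convex_convexHull _ _

theorem vertex_mem_facet (e : Fin M.numElem) {f : Finset (Finset (Fin ν))} {s : Finset (Fin ν)}
    (hs : s ∈ f) : M.vertex e s ∈ M.facet e f := subset_convexHull _ _ (mem_image_of_mem _ hs)

theorem facet_subset_elem (e : Fin M.numElem) {f : Finset (Finset (Fin ν))}
    (hf : f ⊆ (M.shape e).labels ν) : M.facet e f ⊆ M.elem e :=
  convexHull_mono (image_mono hf)

theorem facet_eq (e : Fin M.numElem) (f : Finset (Finset (Fin ν))) :
    M.facet e f = M.map e '' convexHull ℝ (refVertex '' (f : Set (Finset (Fin ν)))) := by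
  have h := (M.map e).toAffineMap.image_convexHull (refVertex '' (f : Set (Finset (Fin ν))))
  rw [image_image] at h
  exact h.symm

theorem finite_facets : M.facets.Finite := by
  have : M.facets ⊆ ⋃ e, (fun f => M.facet e f) '' (M.shape e).facets ν := by
    rintro _ ⟨e, f, hf, rfl⟩
    exact mem_iUnion.2 ⟨e, f, hf, rfl⟩
  exact (Set.finite_iUnion fun e => (ElementShape.facets_finite _).image _).subset this

/-- A facet of an element is cut out by an affine function that is nonnegative on the element. -/
theorem exists_facet_function (e : Fin M.numElem) {f : Finset (Finset (Fin ν))}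
    (hf : f ∈ (M.shape e).facets ν) : f ⊆ (M.shape e).labels ν ∧ ∃ ℓ : Pt ν →ᵃ[ℝ] ℝ,
      (∀ x ∈ M.facet e f, ℓ x = 0) ∧ (∃ x ∈ M.elem e, 0 < ℓ x) ∧
      (∀ s ∈ (M.shape e).labels ν, s ∉ f → ∀ x ∈ M.facet e f,
        (M.shape e).shapeFun s ((M.map e).symm x) = 0) ∧
      ∀ w, ℓ.linear w = 0 → w ∈ vectorSpan ℝ (M.facet e f) := by
  obtain ⟨hsub, ℓ, -, h0, ⟨s, hs, hpos⟩, hshape, hspan⟩ :=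
    (M.shape e).exists_facet_function hf
  have hzero : ∀ x ∈ M.facet e f, ℓ ((M.map e).symm x) = 0 := by
    intro x hx
    have hc : Convex ℝ ((ℓ.comp (M.map e).symm.toAffineMap) ⁻¹' {0}) :=
      (convex_singleton 0).affine_preimage _
    refine convexHull_min ?_ hc hx
    rintro _ ⟨s, hs, rfl⟩
    show ℓ ((M.map e).symm (M.vertex e s)) = 0
    rw [symm_vertex, h0 s hs]
  refine ⟨hsub, ℓ.comp (M.map e).symm.toAffineMap, hzero,
    ⟨M.vertex e s, vertex_mem_elem e hs, ?_⟩, fun s hs hsf x hx => hshape s hs hsf _ (hzero x hx), ?_⟩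
  · show 0 < ℓ ((M.map e).symm (M.vertex e s))
    rw [symm_vertex]
    exact hpos
  · intro w hw
    have h1 := hspan ((M.map e).symm.linear w) hw
    have h2 : vectorSpan ℝ (M.facet e f) = (vectorSpan ℝ
        ((refVertex : _ → Pt ν) '' (f : Set (Finset (Fin ν))))).map (M.map e).toAffineMap.linear := by
      rw [facet, ← direction_affineSpan, affineSpan_convexHull, direction_affineSpan,
        AffineMap.map_vectorSpan, image_image]
      rfl
    rw [h2]
    refine ⟨_, h1, ?_⟩
    show (M.map e).linear ((M.map e).symm.linear w) = w
    exact (M.map e).linear.apply_symm_apply w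

theorem facet_nonempty (hν : 0 < ν) (e : Fin M.numElem) {f : Finset (Finset (Fin ν))}
    (hf : f ∈ (M.shape e).facets ν) : (M.facet e f).Nonempty := by
  have : f.Nonempty := by
    generalize M.shape e = S at hf
    cases S with
    | simplex =>
      obtain ⟨s, hs, rfl⟩ := hf
      by_cases h : s = ∅
      · exact ⟨{⟨0, hν⟩}, Finset.mem_erase.2 ⟨by simp [h], mem_labels_simplex.2 (Or.inr ⟨_, rfl⟩)⟩⟩
      · exact ⟨∅, Finset.mem_erase.2 ⟨Ne.symm h, mem_labels_simplex.2 (Or.inl rfl)⟩⟩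
    | cube =>
      obtain ⟨j, rfl | rfl⟩ := hf
      · exact ⟨{j}, by simp⟩
      · exact ⟨∅, by simp⟩
  obtain ⟨s, hs⟩ := this
  exact ⟨_, vertex_mem_facet e hs⟩

/-- The direction space of the facet is the kernel of a nonzero functional. -/
theorem finrank_vectorSpan_facet (hν : 0 < ν) (e : Fin M.numElem) {f : Finset (Finset (Fin ν))}
    (hf : f ∈ (M.shape e).facets ν) : Module.finrank ℝ (vectorSpan ℝ (M.facet e f)) = ν - 1 := by
  obtain ⟨-, ℓ, h0, ⟨y, -, hy⟩, -, hspan⟩ := exists_facet_function e hf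
  obtain ⟨x, hx⟩ := facet_nonempty hν e hf
  have heq : vectorSpan ℝ (M.facet e f) = LinearMap.ker ℓ.linear := by
    refine le_antisymm ?_ fun w hw => hspan w hw
    rw [vectorSpan_def, Submodule.span_le]
    rintro _ ⟨a, ha, b, hb, rfl⟩
    show ℓ.linear (a -ᵥ b) = 0
    rw [ℓ.linearMap_vsub, h0 a ha, h0 b hb, vsub_self]
  have hne : ℓ.linear ≠ 0 := by
    intro h
    have := ℓ.linearMap_vsub y x
    rw [h, h0 x hx] at this
    simp at this
    linarith
  have h1 := ℓ.linear.finrank_range_add_finrank_ker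
  rw [LinearMap.range_eq_top.2 (LinearMap.surjective hne), finrank_top, Module.finrank_self,
    finrank_euclideanSpace_fin] at h1
  rw [heq]
  omega

theorem mem_affineSpan_of_facet_function {F : Set (Pt ν)} {ℓ : Pt ν →ᵃ[ℝ] ℝ} {x z : Pt ν}
    (hx : x ∈ F) (hx0 : ℓ x = 0) (hspan : ∀ w, ℓ.linear w = 0 → w ∈ vectorSpan ℝ F)
    (hz : ℓ z = 0) : z ∈ affineSpan ℝ F := by
  have h1 : z - x ∈ vectorSpan ℝ F := hspan _ (by
    rw [← vsub_eq_sub, ℓ.linearMap_vsub, hz, hx0, vsub_self])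
  rw [← direction_affineSpan] at h1
  have h2 := AffineSubspace.vadd_mem_of_mem_direction h1 (subset_affineSpan ℝ F hx)
  simpa using h2

/-- A mesh node on a facet is a vertex of that facet. -/
theorem IsPartition.exists_vertex_of_mem_facet {Ω : Set (Pt ν)} (hM : M.IsPartition Ω)
    {p : Pt ν} (hp : p ∈ M.nodes) {e : Fin M.numElem} {f : Finset (Finset (Fin ν))}
    (hf : f ⊆ (M.shape e).labels ν) (hpf : p ∈ M.facet e f) : ∃ s ∈ f, M.vertex e s = p := by
  obtain ⟨e', s, hs, rfl⟩ := hp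
  have h1 : IsExtreme ℝ (M.elem e') {M.vertex e' s} :=
    isExtreme_singleton.2 (vertex_mem_extremePoints e' hs)
  have hpe := facet_subset_elem e hf hpf
  have h2 : IsExtreme ℝ (M.elem e ∩ M.elem e') {M.vertex e' s} :=
    h1.mono inter_subset_right (singleton_subset_iff.2 ⟨hpe, vertex_mem_elem e' hs⟩)
  -- Extremality passes from `e'` to the common face, from there to `e` by transitivity, and then to
  -- the facet. Extreme points of a convex hull are among its generators.
  have h3 := ((hM.face e e').trans h2).mono (facet_subset_elem e hf) (singleton_subset_iff.2 hpf)
  obtain ⟨t, ht, h⟩ := extremePoints_convexHull_subset (𝕜 := ℝ) (isExtreme_singleton.1 h3)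
  exact ⟨t, ht, h⟩

/-- An element is contained in the closure of its interior, so touching the interior of another
element already makes the two interiors overlap. -/
theorem IsPartition.eq_of_mem_interior {Ω : Set (Pt ν)} (hM : M.IsPartition Ω)
    (hint : ∀ e, (interior (M.elem e)).Nonempty) {e e' : Fin M.numElem} {x : Pt ν}
    (hx : x ∈ interior (M.elem e)) (hx' : x ∈ M.elem e') : e = e' := by
  by_contra hne
  have h1 := (convex_elem e').closure_interior_eq_closure_of_nonempty_interior (hint e')
  have h2 : x ∈ closure (interior (M.elem e')) := by
    rw [h1]; exact subset_closure hx'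
  obtain ⟨y, hy, hy'⟩ := mem_closure_iff.1 h2 _ isOpen_interior hx
  exact Set.disjoint_left.1 (hM.disjoint hne) hy hy'

/-- Two distinct elements at x would cover a neighbourhood of x, which would put x in the interior
of the closure of Ω. -/
theorem IsPartition.eq_of_mem_intrinsicInterior {Ω : Set (Pt ν)} (hM : M.IsPartition Ω)
    (hint : ∀ e, (interior (M.elem e)).Nonempty) {e e' : Fin M.numElem}
    {f : Finset (Finset (Fin ν))} (hf : f ∈ (M.shape e).facets ν) {x : Pt ν}
    (hx : x ∈ intrinsicInterior ℝ (M.facet e f)) (hxΩ : x ∉ interior (closure Ω))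
    (hx' : x ∈ M.elem e') : e = e' := by
  by_contra hne
  obtain ⟨hsub, ℓ, h0, ⟨y, hy, hy0⟩, -, hspan⟩ := exists_facet_function e hf
  have hxF := intrinsicInterior_subset hx
  refine hxΩ (interior_mono ?_ (mem_interior_union_of_mem_intrinsicInterior (convex_elem e)
    (convex_elem e') (hint e') (hM.disjoint hne) (hM.face e e') (facet_subset_elem e hsub) ℓ h0
    (fun z hz => mem_affineSpan_of_facet_function hxF (h0 x hxF) hspan hz) hx hx' hy hy0))
  rw [← hM.cover]
  exact union_subset (subset_iUnion _ _) (subset_iUnion _ _)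

/-! ### Nodal interpolation -/

theorem continuous_localInterp (e : Fin M.numElem) (c : Pt ν → ℝ) :
    Continuous (M.localInterp e c) := by
  refine continuous_finsetSum _ fun s _ => continuous_const.mul ?_
  exact ((M.shape e).continuous_shapeFun s).comp
    ((M.map e).symm.toAffineMap.continuous_of_finiteDimensional)

theorem localInterp_nonneg (e : Fin M.numElem) {c : Pt ν → ℝ} (hc : ∀ p, 0 ≤ c p) {x : Pt ν}
    (hx : x ∈ M.elem e) : 0 ≤ M.localInterp e c x :=
  Finset.sum_nonneg fun s _ =>
    mul_nonneg (hc _) ((M.shape e).shapeFun_nonneg s (mem_elem_iff.1 hx))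

theorem localInterp_one (e : Fin M.numElem) (x : Pt ν) : M.localInterp e (fun _ => 1) x = 1 := by
  simp only [localInterp, one_mul]
  exact (M.shape e).sum_shapeFun _

theorem localInterp_add (e : Fin M.numElem) (c d : Pt ν → ℝ) (x : Pt ν) :
    M.localInterp e (c + d) x = M.localInterp e c x + M.localInterp e d x := by
  simp [localInterp, add_mul, Finset.sum_add_distrib]

theorem localInterp_smul (e : Fin M.numElem) (a : ℝ) (c : Pt ν → ℝ) (x : Pt ν) :
    M.localInterp e (a • c) x = a * M.localInterp e c x := by
  simp [localInterp, Finset.mul_sum, mul_assoc]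

variable (M) in
/-- Nodal interpolation as a linear map. -/
noncomputable def interpLinear : (Pt ν → ℝ) →ₗ[ℝ] (Pt ν → ℝ) where
  toFun := M.interp
  map_add' c d := by
    ext x
    simp only [interp, Pi.add_apply, localInterp_add, ← add_div, ← Finset.sum_add_distrib]
    congr 1
    exact Finset.sum_congr rfl fun e _ => by split_ifs <;> simp
  map_smul' a c := by
    ext x
    simp only [interp, Pi.smul_apply, localInterp_smul, smul_eq_mul, RingHom.id_apply,
      ← mul_div_assoc, Finset.mul_sum]
    congr 1
    exact Finset.sum_congr rfl fun e _ => by split_ifs <;> simp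

theorem interpLinear_apply (c : Pt ν → ℝ) : M.interpLinear c = M.interp c := rfl

theorem interp_nonneg {c : Pt ν → ℝ} (hc : ∀ p, 0 ≤ c p) (x : Pt ν) : 0 ≤ M.interp c x := by
  refine div_nonneg (Finset.sum_nonneg fun e _ => ?_) (Finset.sum_nonneg fun e _ => ?_)
  · split_ifs with h
    · exact localInterp_nonneg e hc h
    · exact le_rfl
  · split_ifs <;> simp

/-- The value is 1 on the mesh and 0 / 0 = 0 off it, so only an inequality holds everywhere. -/
theorem interp_one_le (x : Pt ν) : M.interp (fun _ => 1) x ≤ 1 := by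
  simp only [interp, localInterp_one]
  exact div_self_le_one _

/-- Jensen's inequality, from expanding the nonnegative interpolant of (c - t)² with t the value at
x. Total weight at most one suffices. -/
theorem interp_sq_le (c : Pt ν → ℝ) (x : Pt ν) :
    M.interp c x ^ 2 ≤ M.interp (fun p => c p ^ 2) x := by
  set t := M.interp c x with ht
  have h1 : 0 ≤ M.interp (fun p => (c p - t) ^ 2) x := interp_nonneg (fun p => sq_nonneg _) x
  have h2 : (fun p => (c p - t) ^ 2) =
      (fun p => c p ^ 2) + ((-2 * t) • c + (t ^ 2) • fun _ => (1 : ℝ)) := by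
    ext p
    simp only [Pi.add_apply, Pi.smul_apply, smul_eq_mul]
    ring
  rw [h2, ← interpLinear_apply, map_add, map_add, map_smul, map_smul] at h1
  simp only [interpLinear_apply, Pi.add_apply, Pi.smul_apply, smul_eq_mul, ← ht] at h1
  nlinarith [interp_one_le (M := M) x, sq_nonneg t]

theorem interp_eq_localInterp {e : Fin M.numElem} (c : Pt ν → ℝ) {x : Pt ν} (hx : x ∈ M.elem e)
    (huniq : ∀ e', x ∈ M.elem e' → e = e') : M.interp c x = M.localInterp e c x := by
  have h : ∀ (g : Fin M.numElem → ℝ), (∑ e', open Classical in if x ∈ M.elem e' then g e' else 0) = g e := by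
    intro g
    rw [Finset.sum_eq_single e]
    · simp [hx]
    · intro e' _ hne
      rw [if_neg fun h => hne (huniq e' h).symm]
    · simp
  unfold interp
  rw [h, h (fun _ => 1), div_one]

theorem measurable_interp (c : Pt ν → ℝ) : Measurable (M.interp c) := by
  refine Measurable.div (Finset.measurable_sum _ fun e _ => ?_)
    (Finset.measurable_sum _ fun e _ => ?_)
  · exact Measurable.ite (isCompact_elem e).measurableSet (continuous_localInterp e c).measurable
      measurable_const
  · exact Measurable.ite (isCompact_elem e).measurableSet measurable_const measurable_const

theorem nodal_nonneg (p x : Pt ν) : 0 ≤ M.nodal p x :=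
  interp_nonneg (fun q => by
    classical
    by_cases h : q = p
    · subst h; simp
    · simp [h]) x

theorem nodal_le_one (p x : Pt ν) : M.nodal p x ≤ 1 := by
  classical
  have h1 : 0 ≤ M.interp ((fun _ => 1) - Pi.single p 1) x := interp_nonneg (fun q => by
    by_cases h : q = p
    · subst h; simp
    · simp [h]) x
  rw [← interpLinear_apply, map_sub, Pi.sub_apply] at h1
  have h2 : M.interpLinear (Pi.single p 1) x = M.nodal p x := by
    simp only [nodal, interpLinear_apply]
  rw [h2, interpLinear_apply] at h1
  linarith [interp_one_le (M := M) x]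

theorem exists_vertex_of_nodal_ne_zero {p x : Pt ν} (h : M.nodal p x ≠ 0) :
    ∃ e, x ∈ M.elem e ∧ p ∈ M.elem e := by
  by_contra! hc
  refine h ?_
  unfold nodal interp
  rw [Finset.sum_eq_zero, zero_div]
  intro e _
  split_ifs with hx
  · refine Finset.sum_eq_zero fun s hs => ?_
    rw [Pi.single_eq_of_ne, zero_mul]
    rintro rfl
    exact hc e hx (vertex_mem_elem e hs)
  · rfl

theorem diam_elem_le_meshSize (e : Fin M.numElem) : Metric.diam (M.elem e) ≤ M.meshSize :=
  le_ciSup (f := fun e => Metric.diam (M.elem e)) (Set.finite_range _).bddAbove e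

theorem nodal_le_indicator (p x : Pt ν) :
    M.nodal p x ≤ (Metric.closedBall p M.meshSize).indicator (fun _ => 1) x := by
  by_cases h : x ∈ Metric.closedBall p M.meshSize
  · rw [indicator_of_mem h]
    exact nodal_le_one p x
  · rw [indicator_of_notMem h]
    by_contra! hc
    obtain ⟨e, hx, hp⟩ := exists_vertex_of_nodal_ne_zero hc.ne'
    exact h ((Metric.dist_le_diam_of_mem (isCompact_elem e).isBounded hx hp).trans
      (diam_elem_le_meshSize e))

/-- Around the vertex of a face `f` where the nodal values are largest, the interpolant keeps half
of that value. -/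
theorem half_le_abs_localInterp (hν : ν = 2 ∨ ν = 3) (e : Fin M.numElem)
    {f : Finset (Finset (Fin ν))} (hf : f ⊆ (M.shape e).labels ν) (c : Pt ν → ℝ)
    {q : Finset (Fin ν)} (hq : q ∈ f) (hmax : ∀ s ∈ f, |c (M.vertex e s)| ≤ |c (M.vertex e q)|)
    {x : Pt ν} (hx : x ∈ M.elem e)
    (hzero : ∀ s ∈ (M.shape e).labels ν, s ∉ f → (M.shape e).shapeFun s
      ((M.map e).symm (AffineMap.homothety (M.vertex e q) (1 / 12 : ℝ) x)) = 0) :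
    |c (M.vertex e q)| / 2 ≤
      |M.localInterp e c (AffineMap.homothety (M.vertex e q) (1 / 12 : ℝ) x)| := by
  classical
  set y := AffineMap.homothety (M.vertex e q) (1 / 12 : ℝ) x with hy
  have hye : y ∈ M.elem e := by
    have := (convex_elem e).lineMap_mem (vertex_mem_elem e (hf hq)) hx
      (t := (1 / 12 : ℝ)) ⟨by norm_num, by norm_num⟩
    exact this
  let φ : Finset (Fin ν) → ℝ := fun s => (M.shape e).shapeFun s ((M.map e).symm y)
  have hφ0 : ∀ s, 0 ≤ φ s := fun s => (M.shape e).shapeFun_nonneg s (mem_elem_iff.1 hye)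
  have hsub : ∀ g : Finset (Fin ν) → ℝ, ∑ s ∈ (M.shape e).labels ν, g s * φ s =
      g q * φ q + ∑ s ∈ f.erase q, g s * φ s := by
    intro g
    rw [Finset.add_sum_erase f (fun s => g s * φ s) hq]
    refine (Finset.sum_subset hf fun s hs hsf => ?_).symm
    rw [show φ s = 0 from hzero s hs hsf, mul_zero]
  have hsum := hsub fun _ => 1
  simp only [one_mul] at hsum
  rw [show ∑ s ∈ (M.shape e).labels ν, φ s = 1 from (M.shape e).sum_shapeFun _] at hsum
  -- The ratio 1/12 is chosen so that 1 - ν/12 ≥ 3/4 for ν ≤ 3. The other vertices of `f` then carry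
  -- total weight at most 1/4, which leaves 3/4 - 1/4 = 1/2.
  have hφq : 3 / 4 ≤ φ q := by
    have h1 := (M.shape e).le_shapeFun_near_vertex (by omega) (hf hq) (mem_elem_iff.1 hx)
      (t := 1 / 12) (by norm_num) (by norm_num)
    have h2 : (M.map e).symm y =
        AffineMap.homothety (refVertex q) (1 / 12 : ℝ) ((M.map e).symm x) := by
      rw [hy, ← symm_vertex e q]
      exact (M.map e).symm.toAffineMap.apply_lineMap _ _ _
    simp only [φ, h2]
    refine le_trans ?_ h1
    rcases hν with rfl | rfl <;> norm_num
  have hloc : M.localInterp e c y =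
      c (M.vertex e q) * φ q + ∑ s ∈ f.erase q, c (M.vertex e s) * φ s := hsub fun s => c (M.vertex e s)
  have hrest : |∑ s ∈ f.erase q, c (M.vertex e s) * φ s| ≤
      |c (M.vertex e q)| * ∑ s ∈ f.erase q, φ s := by
    rw [Finset.mul_sum]
    refine (Finset.abs_sum_le_sum_abs _ _).trans (Finset.sum_le_sum fun s hs => ?_)
    rw [abs_mul, abs_of_nonneg (hφ0 s)]
    exact mul_le_mul_of_nonneg_right (hmax s (Finset.mem_of_mem_erase hs)) (hφ0 s)
  rw [hloc]
  have h3 := abs_sub_abs_le_abs_sub (c (M.vertex e q) * φ q)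
    (-∑ s ∈ f.erase q, c (M.vertex e s) * φ s)
  rw [sub_neg_eq_add, abs_neg, abs_mul, abs_of_nonneg (hφ0 q)] at h3
  nlinarith [abs_nonneg (c (M.vertex e q))]

end Mesh

end RomFom

namespace RomFom

open scoped Topology
open Filter

variable {ν : ℕ}

/-! ### Consequences of quasi-uniformity -/

/-- Gives a uniform real lower bound for the areas of the finitely many reference facets. -/
theorem exists_pos_le_of_finite {α : Type*} {A : Set α} (hA : A.Finite) (g : α → ENNReal)
    (hg : ∀ a ∈ A, 0 < g a) : ∃ m : ℝ, 0 < m ∧ ∀ a ∈ A, ENNReal.ofReal m ≤ g a := by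
  induction A, hA using Set.Finite.induction_on with
  | empty => exact ⟨1, one_pos, by simp⟩
  | @insert a s _ _ ih =>
    obtain ⟨m, hm, h⟩ := ih fun b hb => hg b (mem_insert_of_mem _ hb)
    obtain ⟨r, hr, hr'⟩ := ENNReal.lt_iff_exists_nnreal_btwn.1 (hg a (mem_insert _ _))
    refine ⟨min m r, lt_min hm (by exact_mod_cast hr), ?_⟩
    rintro b (rfl | hb)
    · refine (ENNReal.ofReal_le_ofReal (min_le_right _ _)).trans ?_
      rw [ENNReal.ofReal_coe_nnreal]
      exact hr'.le
    · exact (ENNReal.ofReal_le_ofReal (min_le_left _ _)).trans (h b hb)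

theorem homothety_mem {K : Set (Pt ν)} (hK : Convex ℝ K) {p x : Pt ν} (hp : p ∈ K) (hx : x ∈ K) :
    AffineMap.homothety p (1 / 12 : ℝ) x ∈ K :=
  hK.lineMap_mem hp hx (t := (1 / 12 : ℝ)) ⟨by norm_num, by norm_num⟩

namespace Mesh

variable {M : Mesh ν}

theorem euclideanHausdorffMeasure_facet (hν : 0 < ν) (e : Fin M.numElem)
    {f : Finset (Finset (Fin ν))} (hf : f ∈ (M.shape e).facets ν) :
    μHE[ν - 1] (M.facet e f) < ⊤ ∧ 0 < μHE[ν - 1] (M.facet e f) ∧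
      μHE[ν - 1] (M.facet e f \ intrinsicInterior ℝ (M.facet e f)) = 0 :=
  euclideanHausdorffMeasure_convex (convex_facet e f) (isCompact_facet e f)
    (facet_nonempty hν e hf) (finrank_vectorSpan_facet hν e hf)

/-- The inverse element map sends the inscribed ball into the unit cube, whose diameter √ν is at
most 2. Its linear part therefore has norm at most 2 / ρ. -/
theorem dist_symm_le (hν : ν = 2 ∨ ν = 3) {e : Fin M.numElem} {c : Pt ν} {ρ : ℝ} (hρ : 0 < ρ)
    (hball : Metric.closedBall c ρ ⊆ M.elem e) (x y : Pt ν) :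
    dist ((M.map e).symm x) ((M.map e).symm y) ≤ 2 / ρ * dist x y := by
  rcases eq_or_ne x y with rfl | hne
  · simp
  have hd : 0 < dist x y := dist_pos.2 hne
  set L := (M.map e).symm.linear with hL
  have h1 : (M.map e).symm x - (M.map e).symm y = L (x - y) := by
    rw [← vsub_eq_sub, ← vsub_eq_sub]
    exact ((M.map e).symm.toAffineMap.linearMap_vsub x y).symm
  set w := (ρ / dist x y) • (x - y) with hw
  have hwn : ‖w‖ = ρ := by
    rw [hw, norm_smul, ← dist_eq_norm, Real.norm_of_nonneg (by positivity)]
    field_simp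
  have hwc : w + c ∈ M.elem e := hball (by simp [hwn])
  have hcc : c ∈ M.elem e := hball (by simp [hρ.le])
  have h2 : L w = (M.map e).symm (w + c) - (M.map e).symm c := by
    have := (M.map e).symm.toAffineMap.linearMap_vsub (w + c) c
    rw [vsub_eq_sub, add_sub_cancel_right] at this
    exact this
  have h3 : ‖L w‖ ≤ 2 := by
    have hsq : ‖L w‖ ^ 2 ≤ 4 := by
      rw [EuclideanSpace.norm_sq_eq]
      calc ∑ j, ‖(L w) j‖ ^ 2 ≤ ∑ _j : Fin ν, (1 : ℝ) := by
            refine Finset.sum_le_sum fun j _ => ?_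
            have h4 := coord_mem e hwc j
            have h5 := coord_mem e hcc j
            rw [h2, PiLp.sub_apply, Real.norm_eq_abs, sq_abs]
            nlinarith
        _ ≤ 4 := by
            simp only [Finset.sum_const, Finset.card_univ, Fintype.card_fin, nsmul_eq_mul, mul_one]
            rcases hν with rfl | rfl <;> norm_num
    nlinarith [norm_nonneg (L w)]
  rw [dist_eq_norm, h1]
  rw [hw, map_smul, norm_smul, Real.norm_of_nonneg (by positivity), div_mul_eq_mul_div,
    div_le_iff₀ hd] at h3
  rw [div_mul_eq_mul_div, le_div_iff₀ hρ]
  linarith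

/-- The inverse element map is 2 / ρ-Lipschitz and carries the facet onto a reference facet, so it
enlarges area by at most (2 / ρ)^(ν-1). -/
theorem exists_le_measure_facet (hν : ν = 2 ∨ ν = 3) : ∃ m : ℝ, 0 < m ∧
    ∀ (M : Mesh ν) (e : Fin M.numElem) (f : Finset (Finset (Fin ν))), f ∈ (M.shape e).facets ν →
      ∀ (c : Pt ν) (ρ : ℝ), 0 < ρ → Metric.closedBall c ρ ⊆ M.elem e →
        m * ρ ^ (ν - 1) ≤ (μHE[ν - 1] (M.facet e f)).toReal := by
  have href : ∀ S : ElementShape, ∃ m : ℝ, 0 < m ∧ ∀ f ∈ S.facets ν, ENNReal.ofReal m ≤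
      μHE[ν - 1] (convexHull ℝ ((refVertex : _ → Pt ν) '' (f : Set (Finset (Fin ν))))) := fun S =>
    exists_pos_le_of_finite S.facets_finite _ fun f hf =>
      -- The reference element is treated as a mesh with one element and the identity map.
      (euclideanHausdorffMeasure_facet (M := ⟨1, fun _ => S, fun _ => AffineEquiv.refl ℝ _⟩)
        (by omega) 0 hf).2.1
  obtain ⟨m₁, hm₁, h₁⟩ := href .simplex
  obtain ⟨m₂, hm₂, h₂⟩ := href .cube
  refine ⟨min m₁ m₂ / 2 ^ (ν - 1), by positivity, fun M e f hf c ρ hρ hball => ?_⟩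
  have hm : ENNReal.ofReal (min m₁ m₂) ≤
      μHE[ν - 1] (convexHull ℝ ((refVertex : _ → Pt ν) '' (f : Set (Finset (Fin ν))))) := by
    generalize M.shape e = S at hf
    cases S with
    | simplex => exact (ENNReal.ofReal_le_ofReal (min_le_left _ _)).trans (h₁ f hf)
    | cube => exact (ENNReal.ofReal_le_ofReal (min_le_right _ _)).trans (h₂ f hf)
  have hlip : LipschitzWith (2 / ρ).toNNReal (M.map e).symm :=
    LipschitzWith.of_dist_le_mul fun x y => by
      rw [Real.coe_toNNReal _ (by positivity)]
      exact dist_symm_le hν hρ hball x y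
  have himg : (M.map e).symm '' M.facet e f =
      convexHull ℝ ((refVertex : _ → Pt ν) '' (f : Set (Finset (Fin ν)))) := by
    rw [facet_eq, image_image]
    simp
  have hle : μHE[ν - 1] ((M.map e).symm '' M.facet e f) ≤
      ((2 / ρ).toNNReal : ENNReal) ^ (ν - 1) * μHE[ν - 1] (M.facet e f) := by
    simp only [Measure.euclideanHausdorffMeasure_def, Measure.smul_apply]
    rw [mul_smul_comm]
    refine smul_le_smul_of_nonneg_left ?_ zero_le
    have := hlip.hausdorffMeasure_image_le (d := ((ν - 1 : ℕ) : ℝ)) (by positivity) (M.facet e f)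
    rwa [ENNReal.rpow_natCast] at this
  rw [himg] at hle
  have hfin := (euclideanHausdorffMeasure_facet (by omega) e hf).1
  have h3 := ENNReal.toReal_mono (ENNReal.mul_ne_top (by simp) hfin.ne) (hm.trans hle)
  rw [ENNReal.toReal_ofReal (by positivity), ENNReal.toReal_mul, ENNReal.toReal_pow,
    ENNReal.coe_toReal, Real.coe_toNNReal _ (by positivity), div_pow] at h3
  rw [div_mul_eq_mul_div, div_le_iff₀ (by positivity)]
  rw [div_mul_eq_mul_div, le_div_iff₀ (by positivity)] at h3
  linarith

/-- As ν - 1 ≥ 1, the facet has two distinct vertices. Their reference points are at distance at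
least 1, and the inverse element map is 2 / ρ-Lipschitz. -/
theorem le_diam_facet (hν : ν = 2 ∨ ν = 3) {e : Fin M.numElem} {f : Finset (Finset (Fin ν))}
    (hf : f ∈ (M.shape e).facets ν) {c : Pt ν} {ρ : ℝ} (hρ : 0 < ρ)
    (hball : Metric.closedBall c ρ ⊆ M.elem e) : ρ / 2 ≤ Metric.diam (M.facet e f) := by
  have hrank := finrank_vectorSpan_facet (by omega) e hf
  obtain ⟨s, hs, t, ht, hst⟩ : ∃ s ∈ f, ∃ t ∈ f, s ≠ t := by
    by_contra! hc
    have hsub : (M.vertex e '' (f : Set (Finset (Fin ν)))).Subsingleton := by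
      rintro _ ⟨s, hs, rfl⟩ _ ⟨t, ht, rfl⟩
      rw [hc s hs t ht]
    have : vectorSpan ℝ (M.facet e f) = ⊥ := by
      rw [facet, ← direction_affineSpan, affineSpan_convexHull, direction_affineSpan]
      exact vectorSpan_of_subsingleton ℝ hsub
    rw [this, finrank_bot] at hrank
    omega
  have h1 := one_le_dist_refVertex hst
  have h2 := dist_symm_le hν hρ hball (M.vertex e s) (M.vertex e t)
  rw [symm_vertex, symm_vertex] at h2
  have h3 := Metric.dist_le_diam_of_mem (isCompact_facet e f).isBounded
    (vertex_mem_facet e hs) (vertex_mem_facet e ht)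
  have h4 : 1 ≤ 2 / ρ * dist (M.vertex e s) (M.vertex e t) := h1.trans h2
  rw [div_mul_eq_mul_div, le_div_iff₀ hρ] at h4
  linarith

/-- Chaining the two conditions gives h ≤ |τ| |σ| r. Absolute values and the added 1 keep the
denominator positive for arbitrary real σ, τ. -/
theorem QuasiUniform.exists_ball {σ τ : ℝ} (h : M.QuasiUniform σ τ) (e : Fin M.numElem) :
    ∃ c, Metric.closedBall c (M.meshSize / (|σ| * |τ| + 1)) ⊆ M.elem e := by
  obtain ⟨c, r, hr, hball, hd⟩ := h.shapeRegular e
  refine ⟨c, (Metric.closedBall_subset_closedBall ?_).trans hball⟩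
  rw [div_le_iff₀ (by positivity)]
  have h1 := h.uniform e
  have h2 : τ * Metric.diam (M.elem e) ≤ |τ| * Metric.diam (M.elem e) :=
    mul_le_mul_of_nonneg_right (le_abs_self _) Metric.diam_nonneg
  have h3 : |τ| * Metric.diam (M.elem e) ≤ |τ| * (|σ| * r) :=
    mul_le_mul_of_nonneg_left (hd.trans (mul_le_mul_of_nonneg_right (le_abs_self _) hr.le))
      (abs_nonneg _)
  linarith

theorem meshSize_pos (hν : 0 < ν) (e : Fin M.numElem) : 0 < M.meshSize := by
  refine lt_of_lt_of_le ?_ (diam_elem_le_meshSize e)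
  have h0 : (∅ : Finset (Fin ν)) ∈ (M.shape e).labels ν := by
    cases M.shape e with
    | simplex => exact mem_labels_simplex.2 (Or.inl rfl)
    | cube => exact Finset.mem_univ _
  have h1 : ({⟨0, hν⟩} : Finset (Fin ν)) ∈ (M.shape e).labels ν := by
    cases M.shape e with
    | simplex => exact mem_labels_simplex.2 (Or.inr ⟨_, rfl⟩)
    | cube => exact Finset.mem_univ _
  refine lt_of_lt_of_le (dist_pos.2 ?_) (Metric.dist_le_diam_of_mem (isCompact_elem e).isBounded
    (vertex_mem_elem e h0) (vertex_mem_elem e h1))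
  exact fun h => Finset.singleton_ne_empty _ (vertex_injective e h).symm

theorem interp_bounded {c : Pt ν → ℝ} {B : ℝ} (hc : ∀ p, |c p| ≤ B) (x : Pt ν) :
    M.interp c x ^ 2 ≤ B ^ 2 := by
  refine (interp_sq_le c x).trans ?_
  have h1 : 0 ≤ M.interp ((B ^ 2) • (fun _ => 1) - fun p => c p ^ 2) x := by
    refine interp_nonneg (fun p => ?_) x
    simp only [Pi.sub_apply, Pi.smul_apply, smul_eq_mul, mul_one, sub_nonneg]
    exact sq_le_sq.2 ((hc p).trans (le_abs_self B))
  rw [← interpLinear_apply, map_sub, map_smul, Pi.sub_apply, Pi.smul_apply, smul_eq_mul,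
    interpLinear_apply, interpLinear_apply] at h1
  nlinarith [interp_one_le (M := M) x, sq_nonneg B]

theorem integrable_interp_sq {c : Pt ν → ℝ} {B : ℝ} (hc : ∀ p, |c p| ≤ B) (μ : Measure (Pt ν))
    [IsFiniteMeasure μ] : Integrable (fun x => M.interp c x ^ 2) μ := by
  refine Integrable.of_bound ((measurable_interp c).pow_const 2).aestronglyMeasurable (B ^ 2)
    (ae_of_all _ fun x => ?_)
  rw [Real.norm_of_nonneg (sq_nonneg _)]
  exact interp_bounded hc x

theorem IsPartition.volume_lt_top {Ω : Set (Pt ν)} (hM : M.IsPartition Ω) : volume Ω < ⊤ := by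
  refine lt_of_le_of_lt (measure_mono subset_closure) ?_
  rw [← hM.cover]
  exact (isCompact_iUnion isCompact_elem).measure_lt_top

/-- A finite element function with a nonzero nodal value is nonzero in `L²(Ω)`. -/
theorem IsPartition.integral_interp_sq_pos (hν : ν = 2 ∨ ν = 3) {Ω : Set (Pt ν)} (hΩ : IsOpen Ω)
    (hM : M.IsPartition Ω) (hint : ∀ e, (interior (M.elem e)).Nonempty) {c : Pt ν → ℝ} {B : ℝ}
    (hc : ∀ p, |c p| ≤ B) {p : Pt ν} (hp : p ∈ M.nodes) (hcp : c p ≠ 0) :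
    0 < ∫ x in Ω, M.interp c x ^ 2 := by
  obtain ⟨e, s, hs, rfl⟩ := hp
  obtain ⟨q, hq, hmax⟩ := Finset.exists_max_image ((M.shape e).labels ν)
    (fun s => |c (M.vertex e s)|) ⟨s, hs⟩
  have hcq : 0 < |c (M.vertex e q)| := (abs_pos.2 hcp).trans_le (hmax s hs)
  let H := AffineMap.homothety (M.vertex e q) (1 / 12 : ℝ)
  have hO : IsOpen (H '' interior (M.elem e)) :=
    AffineMap.homothety_isOpenMap _ _ (by norm_num) _ isOpen_interior
  have hOe : H '' interior (M.elem e) ⊆ M.elem e := by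
    rintro _ ⟨x, hx, rfl⟩
    exact homothety_mem (convex_elem e) (vertex_mem_elem e hq) (interior_subset hx)
  obtain ⟨x₀, hx₀⟩ := hint e
  -- Elements lie only in the closure of Ω, so positive measure inside Ω comes from an open set
  -- meeting that closure.
  have hne : ((H '' interior (M.elem e)) ∩ Ω).Nonempty := by
    have h1 : H x₀ ∈ closure Ω := by
      rw [← hM.cover]
      exact mem_iUnion.2 ⟨e, hOe (mem_image_of_mem _ hx₀)⟩
    exact mem_closure_iff.1 h1 _ hO (mem_image_of_mem _ hx₀)
  have : IsFiniteMeasure (volume.restrict Ω) := ⟨by simpa using hM.volume_lt_top⟩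
  rw [integral_pos_iff_support_of_nonneg (fun x => sq_nonneg _) (integrable_interp_sq hc _)]
  refine lt_of_lt_of_le ((hO.inter hΩ).measure_pos volume hne) ?_
  rw [← Measure.restrict_apply hO.measurableSet]
  refine measure_mono fun x hx => ?_
  obtain ⟨y, hy, rfl⟩ := hx
  have hxint : H y ∈ interior (M.elem e) := interior_maximal hOe hO (mem_image_of_mem _ hy)
  have h2 := half_le_abs_localInterp hν e subset_rfl c hq hmax (interior_subset hy)
    fun s hs hs' => absurd hs hs'
  rw [Function.mem_support,
    interp_eq_localInterp c (interior_subset hxint) fun e' he' => hM.eq_of_mem_interior hint hxint he']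
  refine pow_ne_zero 2 (abs_pos.1 (lt_of_lt_of_le (by positivity) h2))

end Mesh

end RomFom

namespace RomFom

open scoped Topology
open Filter

variable {ν : ℕ}

/-! ### Finite element functions with given nodal values -/

open Classical in
/-- The nodal values `c k` at the points `g k`, and zero elsewhere. -/
noncomputable def nodalValues {ι : Type*} [Fintype ι] (g : ι → Pt ν) (c : ι → ℝ) : Pt ν → ℝ :=
  ∑ k, c k • Pi.single (g k) 1

section nodalValues

variable {ι : Type*} [Fintype ι] {g : ι → Pt ν}

theorem nodalValues_apply (hg : Function.Injective g) (c : ι → ℝ) (k : ι) :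
    nodalValues g c (g k) = c k := by
  classical
  rw [nodalValues, Finset.sum_apply, Finset.sum_eq_single k]
  · simp
  · intro l _ hl
    rw [Pi.smul_apply, Pi.single_eq_of_ne fun h => hl (hg h).symm, smul_zero]
  · simp

theorem nodalValues_of_notMem (c : ι → ℝ) {q : Pt ν} (hq : ∀ k, g k ≠ q) :
    nodalValues g c q = 0 := by
  classical
  rw [nodalValues, Finset.sum_apply]
  refine Finset.sum_eq_zero fun k _ => ?_
  rw [Pi.smul_apply, Pi.single_eq_of_ne (hq k).symm, smul_zero]

theorem nodalValues_sq (hg : Function.Injective g) (c : ι → ℝ) :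
    (fun q => nodalValues g c q ^ 2) = nodalValues g fun k => c k ^ 2 := by
  ext q
  by_cases h : ∃ k, g k = q
  · obtain ⟨k, rfl⟩ := h
    rw [nodalValues_apply hg, nodalValues_apply hg]
  · push Not at h
    rw [nodalValues_of_notMem c h, nodalValues_of_notMem _ h]
    simp

theorem abs_nodalValues_le (hg : Function.Injective g) (c : ι → ℝ) (q : Pt ν) :
    |nodalValues g c q| ≤ ∑ k, |c k| := by
  by_cases h : ∃ k, g k = q
  · obtain ⟨k, rfl⟩ := h
    rw [nodalValues_apply hg]
    exact Finset.single_le_sum (f := fun k => |c k|) (fun k _ => abs_nonneg _) (Finset.mem_univ k)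
  · push Not at h
    rw [nodalValues_of_notMem c h, abs_zero]
    exact Finset.sum_nonneg fun k _ => abs_nonneg _

theorem interp_nodalValues (M : Mesh ν) (c : ι → ℝ) :
    M.interp (nodalValues g c) = ∑ k, c k • M.nodal (g k) := by
  rw [← Mesh.interpLinear_apply, nodalValues, map_sum]
  simp only [map_smul]
  rfl

/-- The `L²` norm of a finite element function is controlled by its nodal values. -/
theorem integral_interp_nodalValues_sq_le (M : Mesh ν) (hg : Function.Injective g) (c : ι → ℝ)
    {Ω : Set (Pt ν)} (hΩ : volume Ω < ⊤) :
    ∫ x in Ω, M.interp (nodalValues g c) x ^ 2 ≤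
      (∑ k, c k ^ 2) * (M.meshSize ^ ν * (volume (Metric.closedBall (0 : Pt ν) 1)).toReal) := by
  have hfin : IsFiniteMeasure (volume.restrict Ω) := ⟨by simpa using hΩ⟩
  have hh : 0 ≤ M.meshSize := Real.iSup_nonneg fun e => Metric.diam_nonneg
  have hb : ∀ k, MeasurableSet (Metric.closedBall (g k) M.meshSize) := fun k =>
    Metric.isClosed_closedBall.measurableSet
  have hint : ∀ k, Integrable (fun x => c k ^ 2 *
      (Metric.closedBall (g k) M.meshSize).indicator (fun _ => (1 : ℝ)) x) (volume.restrict Ω) :=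
    fun k => ((integrable_const 1).indicator (hb k)).const_mul _
  -- Jensen removes the cross terms; each basis function is then bounded by the indicator of a ball
  -- of radius h about its node.
  calc ∫ x in Ω, M.interp (nodalValues g c) x ^ 2
      ≤ ∫ x in Ω, ∑ k, c k ^ 2 *
        (Metric.closedBall (g k) M.meshSize).indicator (fun _ => (1 : ℝ)) x := by
        refine integral_mono (Mesh.integrable_interp_sq (abs_nodalValues_le hg c) _)
          (integrable_finsetSum _ fun k _ => hint k) fun x => ?_
        refine (Mesh.interp_sq_le _ x).trans ?_
        rw [nodalValues_sq hg, interp_nodalValues, Finset.sum_apply]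
        exact Finset.sum_le_sum fun k _ =>
          mul_le_mul_of_nonneg_left (Mesh.nodal_le_indicator _ _) (sq_nonneg _)
    _ = ∑ k, c k ^ 2 * ((volume.restrict Ω) (Metric.closedBall (g k) M.meshSize)).toReal := by
        rw [integral_finsetSum _ fun k _ => hint k]
        refine Finset.sum_congr rfl fun k _ => ?_
        rw [integral_const_mul, integral_indicator (hb k)]
        simp [Measure.real]
    _ ≤ ∑ k, c k ^ 2 * (M.meshSize ^ ν * (volume (Metric.closedBall (0 : Pt ν) 1)).toReal) := by
        refine Finset.sum_le_sum fun k _ => mul_le_mul_of_nonneg_left ?_ (sq_nonneg _)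
        have h1 : (volume (Metric.closedBall (g k) M.meshSize)).toReal =
            M.meshSize ^ ν * (volume (Metric.closedBall (0 : Pt ν) 1)).toReal := by
          rw [Measure.addHaar_closedBall' _ _ hh, ENNReal.toReal_mul,
            ENNReal.toReal_ofReal (by positivity), finrank_euclideanSpace_fin]
        rw [← h1]
        exact ENNReal.toReal_mono (isCompact_closedBall _ _).measure_lt_top.ne
          (Measure.restrict_apply_le _ _)
    _ = _ := by rw [Finset.sum_mul]

end nodalValues

/-! ### The interface -/

namespace Decomposition

variable (D : Decomposition ν)

/-- The other subdomain accumulates at x. If the closure of Ω_i filled a neighbourhood of x, it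
would meet that open set, and so would Ω_i itself. -/
theorem notMem_interior_closure (i : Fin 2) {x : Pt ν} (hx : x ∈ D.γ) :
    x ∉ interior (closure (D.Ω i)) := by
  have hdisj : ∀ j, j ≠ i → Disjoint (D.Ω j) (D.Ω i) := by
    intro j hj
    fin_cases i <;> fin_cases j <;> simp_all [D.disjoint, D.disjoint.symm]
  obtain ⟨j, hj⟩ : ∃ j : Fin 2, j ≠ i := exists_ne i
  intro hxi
  have h1 : x ∈ closure (D.Ω j) := frontier_subset_closure (D.γ_subset j hx)
  obtain ⟨y, hy, hy'⟩ := mem_closure_iff.1 h1 _ isOpen_interior hxi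
  obtain ⟨z, hz, hz'⟩ := mem_closure_iff.1 (interior_subset hy) _ (D.isOpen j) hy'
  exact Set.disjoint_left.1 (hdisj j hj) hz hz'

theorem finite_facetsOn (i : Fin 2) : ((D.mesh i).facetsOn D.γ).Finite :=
  Mesh.finite_facets.subset fun _ h => h.1

theorem isCompact_γ : IsCompact D.γ := by
  rw [D.γ_eq 0]
  refine (D.finite_facetsOn 0).isCompact_sUnion ?_
  rintro _ ⟨⟨e, f, -, rfl⟩, -⟩
  exact Mesh.isCompact_facet e f

theorem measure_γ_lt_top (hν : 0 < ν) : μHE[ν - 1] D.γ < ⊤ := by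
  rw [D.γ_eq 0]
  rw [sUnion_eq_biUnion]
  refine (measure_biUnion_lt_top (D.finite_facetsOn 0) ?_)
  rintro _ ⟨⟨e, f, hf, rfl⟩, -⟩
  exact (Mesh.euclideanHausdorffMeasure_facet hν e hf).1

/-- Almost every point of the interface belongs to a single element of each mesh. -/
theorem ae_unique_elem (hν : 0 < ν) (i : Fin 2)
    (hint : ∀ e, (interior ((D.mesh i).elem e)).Nonempty) :
    ∀ᵐ x ∂(μHE[ν - 1] : Measure (Pt ν)).restrict D.γ,
      ∀ e e', x ∈ (D.mesh i).elem e → x ∈ (D.mesh i).elem e' → e = e' := by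
  rw [ae_restrict_iff' D.isCompact_γ.measurableSet]
  have hnull : μHE[ν - 1] (⋃ F ∈ (D.mesh i).facetsOn D.γ, F \ intrinsicInterior ℝ F) = 0 := by
    rw [measure_biUnion_null_iff (D.finite_facetsOn i).countable]
    rintro _ ⟨⟨e, f, hf, rfl⟩, -⟩
    exact (Mesh.euclideanHausdorffMeasure_facet hν e hf).2.2
  refine measure_mono_null (fun x hx => ?_) hnull
  by_contra hx'
  refine hx fun hxγ => ?_
  have h1 := hxγ
  rw [D.γ_eq i] at h1
  obtain ⟨F, hF, hxF⟩ := h1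
  have hxint : x ∈ intrinsicInterior ℝ F := by
    by_contra h
    exact hx' (mem_biUnion hF ⟨hxF, h⟩)
  obtain ⟨⟨e₀, f, hf, rfl⟩, -⟩ := hF
  have h2 : ∀ e, x ∈ (D.mesh i).elem e → e₀ = e := fun e he =>
    (D.isPartition i).eq_of_mem_intrinsicInterior hint hf hxint
      (D.notMem_interior_closure i hxγ) he
  exact fun a b ha hb => (h2 a ha).symm.trans (h2 b hb)

/-- A part of the interface near a node, on which the interpolant is bounded below by the value at
that node. -/
theorem exists_region (hν : ν = 2 ∨ ν = 3) (i : Fin 2) {m : ℝ}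
    (hm : ∀ (M : Mesh ν) (e : Fin M.numElem) (f : Finset (Finset (Fin ν))),
      f ∈ (M.shape e).facets ν → ∀ (c : Pt ν) (ρ : ℝ), 0 < ρ →
        Metric.closedBall c ρ ⊆ M.elem e →
        m * ρ ^ (ν - 1) ≤ (μHE[ν - 1] (M.facet e f)).toReal)
    {ρ : ℝ} (hρ : 0 < ρ) (hball : ∀ e, ∃ c, Metric.closedBall c ρ ⊆ (D.mesh i).elem e)
    (c : Pt ν → ℝ) {p : Pt ν} (hp : p ∈ (D.mesh i).nodes) (hpγ : p ∈ D.γ) :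
    ∃ (e : Fin (D.mesh i).numElem) (R : Set (Pt ν)), R ⊆ D.γ ∧ R ⊆ (D.mesh i).elem e ∧
      MeasurableSet R ∧ (∃ s, (D.mesh i).vertex e s = p) ∧
      (∀ x ∈ R, c p ^ 2 / 4 ≤ (D.mesh i).localInterp e c x ^ 2) ∧
      (1 / 12) ^ (ν - 1) * (m * ρ ^ (ν - 1)) ≤ (μHE[ν - 1] R).toReal := by
  rw [D.γ_eq i] at hpγ
  obtain ⟨_, ⟨⟨e, f, hf, rfl⟩, hFγ⟩, hpF⟩ := hpγ
  obtain ⟨hsub, -, -, -, hzero, -⟩ := Mesh.exists_facet_function e hf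
  obtain ⟨s, hs, hsp⟩ := (D.isPartition i).exists_vertex_of_mem_facet hp hsub hpF
  -- The region sits at the facet vertex with the largest nodal value, not necessarily at p; since
  -- |c p| is no larger, the lower bound still serves p.
  obtain ⟨q, hq, hmax⟩ := Finset.exists_max_image f
    (fun s => |c ((D.mesh i).vertex e s)|) ⟨s, hs⟩
  set F := (D.mesh i).facet e f with hF
  set H := AffineMap.homothety ((D.mesh i).vertex e q) (1 / 12 : ℝ) with hH
  have hHF : H '' F ⊆ F := by
    rintro _ ⟨x, hx, rfl⟩
    exact homothety_mem (Mesh.convex_facet e f) (Mesh.vertex_mem_facet e hq) hx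
  refine ⟨e, H '' F, hHF.trans hFγ, hHF.trans (Mesh.facet_subset_elem e hsub), ?_, ⟨s, hsp⟩, ?_, ?_⟩
  · exact ((Mesh.isCompact_facet e f).image
      (H.continuous_of_finiteDimensional)).measurableSet
  · rintro _ ⟨x, hx, rfl⟩
    have h1 := Mesh.half_le_abs_localInterp hν e hsub c hq hmax
      (Mesh.facet_subset_elem e hsub hx) fun s hs hsf =>
        hzero s hs hsf _ (hHF (mem_image_of_mem _ hx))
    have h2 := hmax s hs
    rw [hsp] at h2
    rw [← sq_abs (c p), ← sq_abs (Mesh.localInterp _ _ _ _)]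
    have h3 : |c p| / 2 ≤ |(D.mesh i).localInterp e c (H x)| := by linarith
    have := pow_le_pow_left₀ (by positivity) h3 2
    linarith
  · rw [euclideanHausdorffMeasure_homothety_image _ _ (by norm_num)]
    obtain ⟨c, hc⟩ := hball e
    have h1 := hm _ e f hf c ρ hρ hc
    rw [ENNReal.smul_def, smul_eq_mul, ENNReal.toReal_mul]
    have h2 : (((‖(1 / 12 : ℝ)‖₊ ^ (ν - 1) : NNReal) : ENNReal)).toReal = (1 / 12) ^ (ν - 1) := by
      simp
    rw [h2]
    exact mul_le_mul_of_nonneg_left h1 (by positivity)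

/-- Inverse trace estimate: the interface nodal values are controlled by the `L²(γ)` norm. -/
theorem sum_sq_le_integral_γ (hν : ν = 2 ∨ ν = 3) (i : Fin 2) {m : ℝ}
    (hm : ∀ (M : Mesh ν) (e : Fin M.numElem) (f : Finset (Finset (Fin ν))),
      f ∈ (M.shape e).facets ν → ∀ (c : Pt ν) (ρ : ℝ), 0 < ρ →
        Metric.closedBall c ρ ⊆ M.elem e →
        m * ρ ^ (ν - 1) ≤ (μHE[ν - 1] (M.facet e f)).toReal)
    {ρ : ℝ} (hρ : 0 < ρ) (hball : ∀ e, ∃ c, Metric.closedBall c ρ ⊆ (D.mesh i).elem e)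
    {ι : Type*} [Fintype ι] {g : ι → Pt ν} (hg : Function.Injective g)
    (hgn : ∀ k, g k ∈ (D.mesh i).nodes) (hgγ : ∀ k, g k ∈ D.γ) (c : ι → ℝ) :
    (1 / 12) ^ (ν - 1) * (m * ρ ^ (ν - 1)) / 4 * ∑ k, c k ^ 2 ≤
      2 ^ ν * ∫ x in D.γ, (D.mesh i).interp (nodalValues g c) x ^ 2 ∂μHE[ν - 1] := by
  classical
  set C := nodalValues g c with hC
  have hint : ∀ e, (interior ((D.mesh i).elem e)).Nonempty := fun e => by
    obtain ⟨y, hy⟩ := hball e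
    exact ⟨y, interior_mono hy (by
      rw [interior_closedBall _ hρ.ne']; exact Metric.mem_ball_self hρ)⟩
  choose e R hRγ hRe hR hRv hRc hRm using fun k =>
    D.exists_region hν i hm hρ hball C (hgn k) (hgγ k)
  have hfin : IsFiniteMeasure ((μHE[ν - 1] : Measure (Pt ν)).restrict D.γ) :=
    ⟨by simpa using D.measure_γ_lt_top (by omega)⟩
  set μ := (μHE[ν - 1] : Measure (Pt ν)).restrict D.γ with hμ
  have hRint : ∀ k, Integrable ((R k).indicator fun _ => c k ^ 2 / 4) μ := fun k =>
    (integrable_const _).indicator (hR k)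
  have hpt : ∀ᵐ x ∂μ, ∑ k, (R k).indicator (fun _ => c k ^ 2 / 4) x ≤
      2 ^ ν * (D.mesh i).interp C x ^ 2 := by
    filter_upwards [D.ae_unique_elem (by omega) i hint] with x hx
    have h1 : ∀ k, (R k).indicator (fun _ => c k ^ 2 / 4) x ≤
        if x ∈ R k then (D.mesh i).interp C x ^ 2 else 0 := by
      intro k
      by_cases h : x ∈ R k
      · rw [indicator_of_mem h, if_pos h,
          Mesh.interp_eq_localInterp C (hRe k h) fun e' he' => hx _ _ (hRe k h) he']
        have := hRc k x h
        rwa [hC, nodalValues_apply hg, ← hC] at this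
      · rw [indicator_of_notMem h, if_neg h]
    refine (Finset.sum_le_sum fun k _ => h1 k).trans ?_
    rw [← Finset.sum_filter, Finset.sum_const, nsmul_eq_mul]
    refine mul_le_mul_of_nonneg_right ?_ (sq_nonneg _)
    -- All regions through x lie in the same element, so a node is determined by its vertex label in
    -- that element, and there are 2^ν subsets available as labels.
    have hcard : (Finset.univ.filter fun k => x ∈ R k).card ≤ 2 ^ ν := by
      choose s hs using hRv
      have hinj : Set.InjOn s (Finset.univ.filter fun k => x ∈ R k) := by
        intro k hk l hl hkl
        have hk : x ∈ R k := (Finset.mem_filter.1 hk).2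
        have hl : x ∈ R l := (Finset.mem_filter.1 hl).2
        refine hg ?_
        rw [← hs k, ← hs l, hkl, hx _ _ (hRe k hk) (hRe l hl)]
      have := Finset.card_le_card_of_injOn s (t := Finset.univ) (fun _ _ => Finset.mem_univ _) hinj
      simpa using this
    exact_mod_cast hcard
  have hle := integral_mono_ae (integrable_finsetSum _ fun k _ => hRint k)
    ((Mesh.integrable_interp_sq (abs_nodalValues_le hg c) μ).const_mul _) hpt
  rw [integral_finsetSum _ fun k _ => hRint k, integral_const_mul] at hle
  refine le_trans ?_ hle
  rw [Finset.mul_sum]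
  refine Finset.sum_le_sum fun k _ => ?_
  rw [integral_indicator (hR k), setIntegral_const, smul_eq_mul, Measure.real, hμ,
    Measure.restrict_apply (hR k), inter_eq_left.2 (hRγ k)]
  have := mul_le_mul_of_nonneg_right (hRm k) (sq_nonneg (c k))
  linarith

end Decomposition

end RomFom

namespace RomFom

variable {ν : ℕ}

/-! ### Gram matrices -/

/-- The quadratic form at c is the integral of the square of ∑ c_k φ_k. -/
theorem posDef_gram {ι : Type*} [Fintype ι] (μ : Measure (Pt ν)) [IsFiniteMeasure μ]
    (φ : ι → Pt ν → ℝ) (hm : ∀ k, Measurable (φ k)) (hb : ∀ k x, |φ k x| ≤ 1)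
    (hpos : ∀ c : ι → ℝ, c ≠ 0 → 0 < ∫ x, (∑ k, c k • φ k) x ^ 2 ∂μ) :
    (Matrix.of fun p q => ∫ x, φ p x * φ q x ∂μ).PosDef := by
  have hint : ∀ p q, Integrable (fun x => φ p x * φ q x) μ := fun p q => by
    refine Integrable.of_bound ((hm p).mul (hm q)).aestronglyMeasurable 1 (ae_of_all _ fun x => ?_)
    rw [norm_mul]
    exact mul_le_one₀ (hb p x) (norm_nonneg _) (hb q x)
  refine Matrix.PosDef.of_dotProduct_mulVec_pos ?_ fun {c} hc => ?_
  · ext p q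
    simp [mul_comm]
  · have h := hpos c hc
    have heq : ∀ x, (∑ k, c k • φ k) x ^ 2 = ∑ p, ∑ q, c p * c q * (φ p x * φ q x) := by
      intro x
      rw [Finset.sum_apply, sq, Finset.sum_mul_sum]
      refine Finset.sum_congr rfl fun p _ => Finset.sum_congr rfl fun q _ => ?_
      simp only [Pi.smul_apply, smul_eq_mul]
      ring
    simp only [heq] at h
    rw [integral_finsetSum _ fun p _ => integrable_finsetSum _ fun q _ => (hint p q).const_mul _] at h
    refine h.trans_eq ?_
    simp only [dotProduct, Matrix.mulVec, Finset.mul_sum]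
    refine Finset.sum_congr rfl fun p _ => ?_
    rw [integral_finsetSum _ fun q _ => (hint p q).const_mul _]
    refine Finset.sum_congr rfl fun q _ => ?_
    rw [integral_const_mul]
    simp
    ring

theorem abs_nodal_le_one (M : Mesh ν) (p x : Pt ν) : |M.nodal p x| ≤ 1 :=
  abs_le.2 ⟨by linarith [Mesh.nodal_nonneg (M := M) p x], Mesh.nodal_le_one p x⟩

/-- A congruence by a block row that acts injectively on row vectors, since its first block is
invertible. -/
theorem posDef_fromCols_zero {m n : Type*} [Fintype m] [Fintype n] [DecidableEq m]
    {A : Matrix m m ℝ} (hA : A.PosDef) {B : Matrix (m ⊕ n) (m ⊕ n) ℝ} (hB : B.PosDef) :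
    (Matrix.fromCols A (0 : Matrix m n ℝ) * B * (Matrix.fromCols A 0)ᵀ).PosDef := by
  rw [← Matrix.conjTranspose_eq_transpose_of_trivial]
  refine hB.mul_mul_conjTranspose_same fun v w h => ?_
  have hinj := Matrix.vecMul_injective_iff_isUnit.2 hA.isUnit
  simp only [Matrix.vecMul_fromCols] at h
  exact hinj (funext fun j => congrFun h (Sum.inl j))

theorem posSemidef_mul_mul_transpose {m n : Type*} [Fintype m] [Fintype n] {A : Matrix n n ℝ}
    (hA : A.PosSemidef) (B : Matrix m n ℝ) : (B * A * Bᵀ).PosSemidef := by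
  rw [← Matrix.conjTranspose_eq_transpose_of_trivial]
  exact hA.mul_mul_conjTranspose_same B

namespace Decomposition

variable (D : Decomposition ν)

/-! ### Traces and lifting of interface functions -/

theorem interfaceFun_eq_interp (i : Fin 2) (c : D.INode i → ℝ) :
    D.interfaceFun i c = (D.mesh i).interp (nodalValues Subtype.val c) :=
  (interp_nodalValues _ c).symm

theorem innerγ_trace (u v : Pt ν → ℝ) :
    D.innerγ (D.trace u) (D.trace v) = ∫ x in D.γ, u x * v x ∂μHE[ν - 1] :=
  integral_subtype_comap D.isCompact_γ.measurableSet fun x => u x * v x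

/-- The interface functions as a linear function of the coefficients. -/
noncomputable def interfaceLinear (i : Fin 2) : (D.INode i → ℝ) →ₗ[ℝ] (Pt ν → ℝ) :=
  Fintype.linearCombination ℝ fun p : D.INode i => (D.mesh i).nodal p

theorem interfaceLinear_apply (i : Fin 2) (c : D.INode i → ℝ) :
    D.interfaceLinear i c = D.interfaceFun i c := Fintype.linearCombination_apply ℝ _ c

theorem mem_interfaceSpace {i : Fin 2} {d : Type} [Fintype d] {Φ : Matrix (D.INode i) d ℝ}
    {u : Pt ν → ℝ} : u ∈ D.interfaceSpace i Φ ↔ ∃ c, u = D.interfaceFun i (Φ *ᵥ c) := by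
  rw [interfaceSpace, Submodule.mem_span_range_iff_exists_fun]
  refine exists_congr fun c => ?_
  have h : D.interfaceFun i (Φ *ᵥ c) = ∑ j, c j • D.interfaceFun i (Φ.col j) := by
    simp only [← interfaceLinear_apply, ← map_smul, ← map_sum]
    congr 1
    ext p
    simp [Matrix.mulVec, dotProduct, mul_comm]
  rw [h, eq_comm]

theorem mem_reducedTraceSpace {i : Fin 2} {d : Type} [Fintype d] {Φ : Matrix (D.INode i) d ℝ}
    {m : D.γ → ℝ} : m ∈ D.reducedTraceSpace i Φ ↔
      ∃ c, D.interfaceFun i c ∈ D.interfaceSpace i Φ ∧ m = D.trace (D.interfaceFun i c) := by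
  constructor
  · rintro ⟨u, hu, rfl⟩
    obtain ⟨c, rfl⟩ := D.mem_interfaceSpace.1 hu
    exact ⟨_, hu, rfl⟩
  · rintro ⟨c, hc, rfl⟩
    exact ⟨_, hc, rfl⟩

theorem interfaceSize_nonneg (i : Fin 2) : 0 ≤ (D.mesh i).interfaceSize D.γ :=
  Real.sSup_nonneg (by rintro _ ⟨F, -, rfl⟩; exact Metric.diam_nonneg)

theorem interior_elem_nonempty {σ τ : ℝ} {i : Fin 2} (hq : (D.mesh i).QuasiUniform σ τ) (e) :
    (interior ((D.mesh i).elem e)).Nonempty := by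
  obtain ⟨c, r, hr, hball, -⟩ := hq.shapeRegular e
  exact ⟨c, interior_mono hball (by
    rw [interior_closedBall _ hr.ne']; exact Metric.mem_ball_self hr)⟩

/-- The lifting estimate: the domain norm of an interface function is controlled by the norm of its
trace, and the trace determines the function. -/
theorem exists_lifting_bound (hν : ν = 2 ∨ ν = 3) (σ τ : ℝ) : ∃ C > 0, ∀ D : Decomposition ν,
    ∀ i, (D.mesh i).QuasiUniform σ τ → ∀ c : D.INode i → ℝ,
      D.innerΩ i (D.interfaceFun i c) (D.interfaceFun i c) ≤
        C * (D.mesh i).interfaceSize D.γ *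
          D.innerγ (D.trace (D.interfaceFun i c)) (D.trace (D.interfaceFun i c)) ∧
      (c ≠ 0 → 0 < D.innerγ (D.trace (D.interfaceFun i c)) (D.trace (D.interfaceFun i c))) := by
  obtain ⟨m, hm, hfacet⟩ := Mesh.exists_le_measure_facet hν
  set κ : ℝ := |σ| * |τ| + 1 with hκ
  have hκ0 : 0 < κ := by positivity
  set ω : ℝ := (volume (Metric.closedBall (0 : Pt ν) 1)).toReal with hω
  have hω0 : 0 < ω := ENNReal.toReal_pos (Metric.measure_closedBall_pos _ _ one_pos).ne'
    (isCompact_closedBall _ _).measure_lt_top.ne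
  set A : ℝ := (1 / 12) ^ (ν - 1) * m / 4 with hA
  have hA0 : 0 < A := by positivity
  -- ω comes from the ball volume, κ^ν from h = κ ρ, 2^ν / A from the inverse trace estimate, and 2
  -- from ρ ≤ 2 h_{i,γ}.
  refine ⟨ω * κ ^ ν * (2 ^ ν / A) * 2, by positivity, fun D i hq c => ?_⟩
  have hJ : D.innerΩ i (D.interfaceFun i c) (D.interfaceFun i c) ≤
      (∑ p, c p ^ 2) * ((D.mesh i).meshSize ^ ν * ω) := by
    have h := integral_interp_nodalValues_sq_le (D.mesh i)
      (Subtype.val_injective : Function.Injective (Subtype.val : D.INode i → Pt ν)) c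
      (D.isPartition i).volume_lt_top
    simp only [innerΩ, interfaceFun_eq_interp, ← sq]
    exact h
  rw [innerγ_trace]
  set I := ∫ x in D.γ, D.interfaceFun i c x * D.interfaceFun i c x ∂μHE[ν - 1] with hI
  have hI0 : 0 ≤ I := integral_nonneg fun x => mul_self_nonneg _
  have hH0 := D.interfaceSize_nonneg i
  rcases isEmpty_or_nonempty (D.INode i) with hE | ⟨⟨p₀⟩⟩
  · refine ⟨?_, fun hc => absurd (Subsingleton.elim c 0) hc⟩
    refine hJ.trans ?_
    rw [Fintype.sum_empty, zero_mul]
    positivity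
  · obtain ⟨p₀, ⟨e, s, hs, hp₀⟩, hpγ, -⟩ := p₀
    have hh : 0 < (D.mesh i).meshSize := Mesh.meshSize_pos (by omega) e
    set h := (D.mesh i).meshSize with hh'
    set ρ := h / κ with hρ
    have hρ0 : 0 < ρ := by positivity
    have hball := hq.exists_ball
    have hI1 : A * ρ ^ (ν - 1) * ∑ p, c p ^ 2 ≤ 2 ^ ν * I := by
      have h := D.sum_sq_le_integral_γ hν i hfacet hρ0 hball
        (Subtype.val_injective : Function.Injective (Subtype.val : D.INode i → Pt ν))
        (fun p => p.2.1) (fun p => p.2.2.1) c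
      simp only [← interfaceFun_eq_interp, sq (interfaceFun _ _ _ _), ← hI] at h
      refine le_trans (le_of_eq ?_) h
      rw [hA]; ring
    -- An interface node guarantees a facet on γ, and quasi-uniformity bounds its diameter below.
    have hρH : ρ ≤ 2 * (D.mesh i).interfaceSize D.γ := by
      rw [D.γ_eq i] at hpγ
      obtain ⟨_, ⟨⟨e, f, hf, rfl⟩, hFγ⟩, -⟩ := hpγ
      obtain ⟨y, hy⟩ := hball e
      have h1 := Mesh.le_diam_facet hν hf hρ0 hy
      have h2 : Metric.diam ((D.mesh i).facet e f) ≤ (D.mesh i).interfaceSize D.γ :=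
        le_csSup ((D.finite_facetsOn i).image _).bddAbove
          (mem_image_of_mem _ ⟨⟨e, f, hf, rfl⟩, hFγ⟩)
      linarith
    constructor
    · refine hJ.trans ?_
      have hs : ρ ^ (ν - 1) * ∑ p, c p ^ 2 ≤ 2 ^ ν / A * I := by
        rw [div_mul_eq_mul_div, le_div_iff₀ hA0]
        linarith
      -- Of the ν powers of h, the surface measure absorbs ν - 1; the remaining one becomes h_{i,γ}.
      have hhκ : h ^ ν = κ ^ ν * (ρ ^ (ν - 1) * ρ) := by
        rw [← pow_succ, Nat.sub_add_cancel (by omega), ← mul_pow, hρ, mul_div_cancel₀ _ hκ0.ne']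
      calc (∑ p, c p ^ 2) * (h ^ ν * ω)
          = ω * κ ^ ν * ((ρ ^ (ν - 1) * ∑ p, c p ^ 2) * ρ) := by rw [hhκ]; ring
        _ ≤ ω * κ ^ ν * ((2 ^ ν / A * I) * (2 * (D.mesh i).interfaceSize D.γ)) := by gcongr
        _ = _ := by ring
    · intro hc
      obtain ⟨p, hp⟩ := Function.ne_iff.1 hc
      have h1 : 0 < ∑ p, c p ^ 2 :=
        Finset.sum_pos' (fun _ _ => sq_nonneg _) ⟨p, Finset.mem_univ _, by
          have : c p ≠ 0 := hp
          positivity⟩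
      have h2 : 0 < A * ρ ^ (ν - 1) * ∑ p, c p ^ 2 := by positivity
      have h3 : (0 : ℝ) < 2 ^ ν := by positivity
      exact pos_of_mul_pos_right (h2.trans_le hI1) h3.le

/-! ### Mass and constraint matrices -/

theorem posDef_fullMass (hν : ν = 2 ∨ ν = 3) {σ τ : ℝ} (i : Fin 2)
    (hq : (D.mesh i).QuasiUniform σ τ) : (D.fullMass i).PosDef := by
  let g : D.INode i ⊕ D.ONode i → Pt ν := Sum.elim Subtype.val Subtype.val
  have hg : Function.Injective g := by
    -- Interface and interior nodes are distinct because γ lies in the frontier of the open set Ω_i.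
    refine Subtype.val_injective.sumElim Subtype.val_injective ?_
    rintro ⟨p, hp⟩ ⟨q, hq⟩ (rfl : p = q)
    have h1 := D.γ_subset i hp.2.1
    rw [(D.isOpen i).frontier_eq] at h1
    exact h1.2 hq.2
  have hgn : ∀ k, g k ∈ (D.mesh i).nodes := by
    rintro (p | p)
    · exact p.2.1
    · exact p.2.1
  have hfin : IsFiniteMeasure (volume.restrict (D.Ω i)) :=
    ⟨by simpa using (D.isPartition i).volume_lt_top⟩
  have h := posDef_gram (volume.restrict (D.Ω i)) (fun k => (D.mesh i).nodal (g k))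
    (fun k => Mesh.measurable_interp _) (fun k x => abs_nodal_le_one _ _ _) fun c hc => by
      obtain ⟨k, hk⟩ := Function.ne_iff.1 hc
      rw [← interp_nodalValues]
      exact (D.isPartition i).integral_interp_sq_pos hν (D.isOpen i)
        (D.interior_elem_nonempty hq) (abs_nodalValues_le hg c) (hgn k)
        (by rw [nodalValues_apply hg]; exact hk)
  convert h using 1
  ext (p | p) (q | q) <;> rfl

theorem innerΩ_interfaceFun_pos (hν : ν = 2 ∨ ν = 3) {σ τ : ℝ} (i : Fin 2)
    (hq : (D.mesh i).QuasiUniform σ τ) {c : D.INode i → ℝ} (hc : c ≠ 0) :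
    0 < D.innerΩ i (D.interfaceFun i c) (D.interfaceFun i c) := by
  obtain ⟨k, hk⟩ := Function.ne_iff.1 hc
  simp only [innerΩ, interfaceFun_eq_interp, ← sq]
  exact (D.isPartition i).integral_interp_sq_pos hν (D.isOpen i)
    (D.interior_elem_nonempty hq) (abs_nodalValues_le Subtype.val_injective c) k.2.1
    (by rw [nodalValues_apply Subtype.val_injective]; exact hk)

/-- The projected matrix is the congruence of the full one by the injective block diagonal matrix of
the two bases. -/
theorem posDef_reducedMass {i : Fin 2} (h : (D.fullMass i).PosDef) {d d' : Type} [Fintype d]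
    [Fintype d'] {Φγ : Matrix (D.INode i) d ℝ} {Φ0 : Matrix (D.ONode i) d' ℝ}
    (hγ : LinearIndependent ℝ Φγ.col) (h0 : LinearIndependent ℝ Φ0.col) :
    (D.reducedMass i Φγ Φ0).PosDef := by
  have hB : Function.Injective (Matrix.fromBlocks Φγ 0 0 Φ0).mulVec := by
    intro v w hvw
    have h1 := Matrix.mulVec_injective_iff.2 hγ
    have h2 := Matrix.mulVec_injective_iff.2 h0
    simp only [Matrix.fromBlocks_mulVec, Matrix.zero_mulVec, add_zero, zero_add] at hvw
    have h3 := h1 (funext fun p => congrFun hvw (Sum.inl p))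
    have h4 := h2 (funext fun p => congrFun hvw (Sum.inr p))
    ext (j | j)
    · exact congrFun h3 j
    · exact congrFun h4 j
  have := h.conjTranspose_mul_mul_same hB
  rw [Matrix.conjTranspose_eq_transpose_of_trivial] at this
  convert this using 1
  simp [reducedMass, fullMass, Matrix.fromBlocks_transpose, Matrix.fromBlocks_multiply]

theorem posDef_constraint (hν : 0 < ν) (i : Fin 2)
    (hpos : ∀ c : D.INode i → ℝ, c ≠ 0 →
      0 < D.innerγ (D.trace (D.interfaceFun i c)) (D.trace (D.interfaceFun i c))) :
    (D.constraint i i).PosDef := by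
  have hfin : IsFiniteMeasure ((μHE[ν - 1] : Measure (Pt ν)).restrict D.γ) :=
    ⟨by simpa using D.measure_γ_lt_top hν⟩
  have h := posDef_gram ((μHE[ν - 1] : Measure (Pt ν)).restrict D.γ)
    (fun p : D.INode i => (D.mesh i).nodal p) (fun k => Mesh.measurable_interp _)
    (fun k x => abs_nodal_le_one _ _ _) fun c hc => by
      have := hpos c hc
      rw [innerγ_trace] at this
      simp only [sq]
      exact this
  convert h using 1
  ext p q
  exact D.innerγ_trace _ _

section Schur

variable {d d' : Type} [Fintype d] [DecidableEq d] [Fintype d'] [DecidableEq d']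
  {Φγ : Matrix (D.INode 0) d ℝ} {Φ0 : Matrix (D.ONode 0) d' ℝ}

/-- The square block Φᵀ G Φ is positive definite, so the ROM side is definite and the FOM side need
only be semidefinite. For fLM the roles are exchanged. -/
theorem posDef_schurRLM (h0 : (D.reducedMass 0 Φγ Φ0).PosDef) (h1 : (D.fullMass 1).PosDef)
    (hG : (D.constraint 0 0).PosDef) (hγ : LinearIndependent ℝ Φγ.col) :
    (D.schurRLM Φγ Φ0).PosDef := by
  have hA := hG.conjTranspose_mul_mul_same (Matrix.mulVec_injective_iff.2 hγ)
  rw [Matrix.conjTranspose_eq_transpose_of_trivial] at hA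
  exact (posDef_fromCols_zero hA h0.inv).add_posSemidef (posSemidef_mul_mul_transpose
    h1.inv.posSemidef (Matrix.fromCols (Φγᵀ * D.constraint 0 1) 0))

theorem posDef_schurFLM (h0 : (D.reducedMass 0 Φγ Φ0).PosDef) (h1 : (D.fullMass 1).PosDef)
    (hG : (D.constraint 1 1).PosDef) : (D.schurFLM Φγ Φ0).PosDef :=
  Matrix.PosDef.posSemidef_add (posSemidef_mul_mul_transpose h0.inv.posSemidef
    (Matrix.fromCols (D.constraint 1 0 * Φγ) 0)) (posDef_fromCols_zero hG h1.inv)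

end Schur

/-! ### The lifting operator and the inf-sup condition -/

/-- The state whose component on side `i` is `±u` and whose other component is zero; the sign is
that of the component in the constraint form. -/
def inject : Fin 2 → (Pt ν → ℝ) →ₗ[ℝ] (Pt ν → ℝ) × (Pt ν → ℝ) :=
  ![LinearMap.inl ℝ _ _, -LinearMap.inr ℝ _ _]

theorem b_inject (i : Fin 2) (u : Pt ν → ℝ) (m : D.γ → ℝ) :
    D.b (inject i u) m = D.innerγ (D.trace u) m := by
  fin_cases i
  · show D.innerγ (D.trace u - D.trace 0) m = _
    rw [map_zero, sub_zero]
  · show D.innerγ (D.trace (-0) - D.trace (-u)) m = _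
    rw [map_neg, map_neg, map_zero, neg_zero, zero_sub, neg_neg]

theorem normV_inject (i : Fin 2) (u : Pt ν → ℝ) :
    D.normV (inject i u) = Real.sqrt (D.innerΩ i u u) := by
  fin_cases i
  · show Real.sqrt (D.innerΩ 0 u u + D.innerΩ 1 0 0) = _
    simp [innerΩ]
  · show Real.sqrt (D.innerΩ 0 (-0) (-0) + D.innerΩ 1 (-u) (-u)) = _
    simp [innerΩ]

/-- Positivity of the trace norm makes coefficients ↦ trace injective, so it has a linear left
inverse; Q recovers the coefficients and reassembles the function in the domain. -/
theorem exists_lifting {i : Fin 2} {d : Type} [Fintype d] (Φ : Matrix (D.INode i) d ℝ)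
    (hpos : ∀ c : D.INode i → ℝ, c ≠ 0 →
      0 < D.innerγ (D.trace (D.interfaceFun i c)) (D.trace (D.interfaceFun i c)))
    (V : Submodule ℝ ((Pt ν → ℝ) × (Pt ν → ℝ)))
    (hV : ∀ u ∈ D.interfaceSpace i Φ, inject i u ∈ V) :
    ∃ Q : D.reducedTraceSpace i Φ →ₗ[ℝ] V, ∀ (m : D.reducedTraceSpace i Φ) (c : D.INode i → ℝ),
      (m : D.γ → ℝ) = D.trace (D.interfaceFun i c) →
        (Q m : (Pt ν → ℝ) × (Pt ν → ℝ)) = inject i (D.interfaceFun i c) := by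
  let T : (D.INode i → ℝ) →ₗ[ℝ] (D.γ → ℝ) := D.trace ∘ₗ D.interfaceLinear i
  have hT : ∀ c, T c = D.trace (D.interfaceFun i c) := fun c => by
    rw [← interfaceLinear_apply]; rfl
  have hinj : LinearMap.ker T = ⊥ := by
    refine LinearMap.ker_eq_bot'.2 fun c hc => ?_
    by_contra hne
    have h1 := hpos c hne
    rw [← hT, hc] at h1
    simp [innerγ] at h1
  obtain ⟨g, hg⟩ := LinearMap.exists_leftInverse_of_injective T hinj
  have hgT : ∀ c, g (T c) = c := fun c => LinearMap.congr_fun hg c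
  refine ⟨((inject i ∘ₗ D.interfaceLinear i ∘ₗ g) ∘ₗ
    (D.reducedTraceSpace i Φ).subtype).codRestrict V ?_, ?_⟩
  · rintro ⟨m, hm⟩
    obtain ⟨c, hc, rfl⟩ := D.mem_reducedTraceSpace.1 hm
    show inject i (D.interfaceLinear i (g (D.trace (D.interfaceFun i c)))) ∈ V
    rw [← hT, hgT, interfaceLinear_apply]
    exact hV _ hc
  · rintro ⟨m, hm⟩ c (rfl : m = _)
    show inject i (D.interfaceLinear i (g (D.trace (D.interfaceFun i c)))) = _
    rw [← hT, hgT, interfaceLinear_apply]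

theorem normV_inject_le {C : ℝ} (hC : 0 < C) {i : Fin 2} {c : D.INode i → ℝ}
    (h : D.innerΩ i (D.interfaceFun i c) (D.interfaceFun i c) ≤
      C * (D.mesh i).interfaceSize D.γ *
        D.innerγ (D.trace (D.interfaceFun i c)) (D.trace (D.interfaceFun i c))) :
    D.normV (inject i (D.interfaceFun i c)) ≤
      Real.sqrt C * (D.mesh i).interfaceSize D.γ ^ (1 / 2 : ℝ) *
        D.normW (D.trace (D.interfaceFun i c)) := by
  have hH := D.interfaceSize_nonneg i
  rw [normV_inject, normW, ← Real.sqrt_eq_rpow, ← Real.sqrt_mul hC.le, ← Real.sqrt_mul (by positivity)]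
  exact Real.sqrt_le_sqrt h

theorem normW_sq (m : D.γ → ℝ) : D.normW m ^ 2 = D.innerγ m m :=
  Real.sq_sqrt (integral_nonneg fun _ => mul_self_nonneg _)

theorem liftingBounds {C : ℝ} (hC : 0 < C) {i : Fin 2} {d : Type} [Fintype d]
    {Φ : Matrix (D.INode i) d ℝ} {V : Submodule ℝ ((Pt ν → ℝ) × (Pt ν → ℝ))}
    (hb : ∀ c : D.INode i → ℝ, D.innerΩ i (D.interfaceFun i c) (D.interfaceFun i c) ≤
      C * (D.mesh i).interfaceSize D.γ *
        D.innerγ (D.trace (D.interfaceFun i c)) (D.trace (D.interfaceFun i c)))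
    (Q : D.reducedTraceSpace i Φ →ₗ[ℝ] V)
    (hQ : ∀ (m : D.reducedTraceSpace i Φ) (c : D.INode i → ℝ),
      (m : D.γ → ℝ) = D.trace (D.interfaceFun i c) →
        (Q m : (Pt ν → ℝ) × (Pt ν → ℝ)) = inject i (D.interfaceFun i c)) :
    D.LiftingBounds Q 1 (Real.sqrt C) ((D.mesh i).interfaceSize D.γ) := by
  intro m
  obtain ⟨c, -, hc⟩ := D.mem_reducedTraceSpace.1 m.2
  rw [hQ m c hc, hc, b_inject, normW_sq, one_mul]
  exact ⟨le_rfl, D.normV_inject_le hC (hb c)⟩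

/-- The lifted multiplier serves as the test state: b equals ‖μ‖²_W there and its norm is at most √C
‖μ‖_W. -/
theorem infSup (hν : ν = 2 ∨ ν = 3) {σ τ C : ℝ} (hC : 0 < C) {i : Fin 2}
    (hq : (D.mesh i).QuasiUniform σ τ) {d : Type} [Fintype d] {Φ : Matrix (D.INode i) d ℝ}
    {V₁ V₂ : Submodule ℝ (Pt ν → ℝ)}
    (hb : ∀ c : D.INode i → ℝ, D.innerΩ i (D.interfaceFun i c) (D.interfaceFun i c) ≤
      C * (D.mesh i).interfaceSize D.γ *
        D.innerγ (D.trace (D.interfaceFun i c)) (D.trace (D.interfaceFun i c)))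
    (hV : ∀ u ∈ D.interfaceSpace i Φ, inject i u ∈ V₁.prod V₂)
    (hh : (D.mesh i).interfaceSize D.γ < 1) :
    D.InfSup V₁ V₂ (D.reducedTraceSpace i Φ) (Real.sqrt C)⁻¹ := by
  intro m hm
  obtain ⟨c, hcΦ, rfl⟩ := D.mem_reducedTraceSpace.1 hm
  refine le_trans ?_ (le_iSup₂ (f := fun v (_ : v ∈ V₁.prod V₂) =>
    ((D.b v (D.trace (D.interfaceFun i c)) / D.normV v : ℝ) : EReal)) _ (hV _ hcΦ))
  rw [EReal.coe_le_coe_iff, b_inject, ← normW_sq]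
  -- For c = 0 both sides vanish; otherwise the test state has positive norm, so the quotient is a
  -- genuine one.
  rcases eq_or_ne c 0 with rfl | hc
  · have h0 : D.interfaceFun i (0 : D.INode i → ℝ) = 0 := by
      rw [← interfaceLinear_apply, map_zero]
    rw [h0]
    simp [normW, innerγ]
  · have hV0 : 0 < D.normV (inject i (D.interfaceFun i c)) := by
      rw [normV_inject]
      exact Real.sqrt_pos.2 (D.innerΩ_interfaceFun_pos hν i hq hc)
    have hs : 0 < Real.sqrt C := Real.sqrt_pos.2 hC
    have hW0 : 0 ≤ D.normW (D.trace (D.interfaceFun i c)) := Real.sqrt_nonneg _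
    have hle := D.normV_inject_le hC (hb c)
    -- The condition h_{i,γ} < 1 serves only to drop the factor h^(1/2).
    have hH : (D.mesh i).interfaceSize D.γ ^ (1 / 2 : ℝ) ≤ 1 :=
      Real.rpow_le_one (D.interfaceSize_nonneg i) hh.le (by norm_num)
    have hle' : D.normV (inject i (D.interfaceFun i c)) ≤
        Real.sqrt C * D.normW (D.trace (D.interfaceFun i c)) := by
      refine hle.trans (mul_le_mul_of_nonneg_right ?_ hW0)
      exact mul_le_of_le_one_right hs.le hH
    rw [le_div_iff₀ hV0, inv_mul_eq_div, div_mul_eq_mul_div, div_le_iff₀ hs]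
    nlinarith

end Decomposition

end RomFom

/-! ### Choice of the constants and assembly -/

theorem mainTheorem2 (ν : ℕ) (hν : ν = 2 ∨ ν = 3) (σ τ : ℝ) :
    ∃ β > 0, ∃ C₁ > 0, ∃ C₂ > 0,
      ∀ D : RomFom.Decomposition ν, (∀ i, (D.mesh i).QuasiUniform σ τ) →
        -- composite reduced basis ROM on `Ω₁`, finite element FOM on `Ω₂`
        (∀ (d d' : ℕ) (Φγ : Matrix (D.INode 0) (Fin d) ℝ) (Φ0 : Matrix (D.ONode 0) (Fin d') ℝ),
          LinearIndependent ℝ Φγ.col → LinearIndependent ℝ Φ0.col →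
          (D.reducedMass 0 Φγ Φ0).PosDef ∧ (D.fullMass 1).PosDef ∧
          -- option rLM
          (∃ Q : D.reducedTraceSpace 0 Φγ →ₗ[ℝ]
              ((D.compositeSpace 0 Φγ Φ0).prod (D.fullSpace 1) :),
            (∀ (m : D.reducedTraceSpace 0 Φγ) (c : Fin d → ℝ),
              (m : D.γ → ℝ) = D.trace (D.interfaceFun 0 (Φγ *ᵥ c)) →
                (Q m : (RomFom.Pt ν → ℝ) × (RomFom.Pt ν → ℝ)) =
                  (D.interfaceFun 0 (Φγ *ᵥ c), 0)) ∧
            D.LiftingBounds Q C₁ C₂ ((D.mesh 0).interfaceSize D.γ)) ∧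
          ((D.mesh 0).interfaceSize D.γ < 1 →
            D.InfSup (D.compositeSpace 0 Φγ Φ0) (D.fullSpace 1) (D.reducedTraceSpace 0 Φγ) β) ∧
          (D.schurRLM Φγ Φ0).PosDef ∧
          -- option fLM
          (∃ Q : D.traceSpace 1 →ₗ[ℝ]
              ((D.compositeSpace 0 Φγ Φ0).prod (D.fullSpace 1) :),
            (∀ (m : D.traceSpace 1) (c : D.INode 1 → ℝ),
              (m : D.γ → ℝ) = D.trace (D.interfaceFun 1 c) →
                (Q m : (RomFom.Pt ν → ℝ) × (RomFom.Pt ν → ℝ)) = -(0, D.interfaceFun 1 c)) ∧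
            D.LiftingBounds Q C₁ C₂ ((D.mesh 1).interfaceSize D.γ)) ∧
          ((D.mesh 1).interfaceSize D.γ < 1 →
            D.InfSup (D.compositeSpace 0 Φγ Φ0) (D.fullSpace 1) (D.traceSpace 1) β) ∧
          (D.schurFLM Φγ Φ0).PosDef) ∧
        -- the same `β` is an inf-sup constant for the composite reduced basis ROM-ROM coupling
        (∀ (d d' : Fin 2 → ℕ) (Φγ : ∀ i, Matrix (D.INode i) (Fin (d i)) ℝ)
          (Φ0 : ∀ i, Matrix (D.ONode i) (Fin (d' i)) ℝ),
          (∀ i, LinearIndependent ℝ (Φγ i).col) → (∀ i, LinearIndependent ℝ (Φ0 i).col) →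
          ∀ k : Fin 2, (D.mesh k).interfaceSize D.γ < 1 →
            D.InfSup (D.compositeSpace 0 (Φγ 0) (Φ0 0)) (D.compositeSpace 1 (Φγ 1) (Φ0 1))
              (D.reducedTraceSpace k (Φγ k)) β) := by
  obtain ⟨C, hC, hbound⟩ := RomFom.Decomposition.exists_lifting_bound hν σ τ
  have hsC : 0 < Real.sqrt C := Real.sqrt_pos.2 hC
  -- C₁ = 1 because b(Qμ; μ) = ‖μ‖²_W; C₂ = √C and β = 1 / √C come from the single lifting constant,
  -- which is common to both sides.
  refine ⟨(Real.sqrt C)⁻¹, inv_pos.2 hsC, 1, one_pos, Real.sqrt C, hsC, fun D hq => ⟨?_, ?_⟩⟩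
  · intro d d' Φγ Φ0 hγ h0
    have hM := D.posDef_fullMass hν 1 (hq 1)
    have hM0 := D.posDef_reducedMass (D.posDef_fullMass hν 0 (hq 0)) hγ h0
    have hpos := fun i c => (hbound D i (hq i) c).2
    have hV0 : ∀ u ∈ D.interfaceSpace 0 Φγ, RomFom.Decomposition.inject 0 u ∈
        (D.compositeSpace 0 Φγ Φ0).prod (D.fullSpace 1) := fun u hu =>
      ⟨Submodule.mem_sup_left hu, Submodule.zero_mem _⟩
    have hV1 : ∀ u ∈ D.interfaceSpace 1 (1 : Matrix (D.INode 1) (D.INode 1) ℝ),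
        RomFom.Decomposition.inject 1 u ∈
          (D.compositeSpace 0 Φγ Φ0).prod (D.fullSpace 1) := fun u hu =>
      Submodule.neg_mem _ ⟨Submodule.zero_mem _, Submodule.mem_sup_left hu⟩
    obtain ⟨Q₁, hQ₁⟩ := D.exists_lifting Φγ (hpos 0) _ hV0
    obtain ⟨Q₂, hQ₂⟩ := D.exists_lifting 1 (hpos 1) _ hV1
    refine ⟨hM0, hM, ⟨Q₁, fun m c hc => hQ₁ m _ hc, ?_⟩, ?_, ?_, ⟨Q₂, fun m c hc => hQ₂ m c hc, ?_⟩,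
      ?_, ?_⟩
    · exact D.liftingBounds hC (fun c => (hbound D 0 (hq 0) c).1) Q₁ hQ₁
    · exact D.infSup hν hC (hq 0) (fun c => (hbound D 0 (hq 0) c).1) hV0
    · exact D.posDef_schurRLM hM0 hM (D.posDef_constraint (by omega) 0 (hpos 0)) hγ
    · exact D.liftingBounds hC (fun c => (hbound D 1 (hq 1) c).1) Q₂ hQ₂
    · exact D.infSup hν hC (hq 1) (fun c => (hbound D 1 (hq 1) c).1) hV1
    · exact D.posDef_schurFLM hM0 hM (D.posDef_constraint (by omega) 1 (hpos 1))
  · intro d d' Φγ Φ0 _ _ k hk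
    refine D.infSup hν hC (hq k) (fun c => (hbound D k (hq k) c).1) (fun u hu => ?_) hk
    fin_cases k
    · exact ⟨Submodule.mem_sup_left hu, Submodule.zero_mem _⟩
    · exact Submodule.neg_mem _ ⟨Submodule.zero_mem _, Submodule.mem_sup_left hu⟩
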